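/- Let $n,m\ge 0$ be integers, let $p,q$ be real numbers with $1\le p\le 2$ and $q\ge 1$, and let $M_n$ denote the algebra of complex $n\times n$ matrices, $\mathrm{Tr}_1,\mathrm{Tr}_2$ the partial traces over the first and second factor of $M_n\otimes M_m$. For $1\le s<\infty$ let $\|A\|_s=(\mathrm{Tr}\,|A|^s)^{1/s}$ be the Schatten norm, and let $\|A\|_\infty$ be the operator norm. For positive semidefinite $Y\in M_n\otimes M_m$ put $$\Psi_{p,q}(Y)=\Big(\mathrm{Tr}_1\big(\mathrm{Tr}_2\,Y^p\big)^{q/p}\Big)^{1/q}.$$ For Hermitian $X$ put $|||X|||_{p,q}=\inf\{\Psi_{p,q}(A)+\Psi_{p,q}(B): X+A=B,\ A\ge 0,\ B\ge 0\}$. The Carlen--Lieb norm of $Y\in M_n\otimes M_m$ is $$\|Y\|_{CL}=\frac12\,\Big|\Big|\Big|\begin{pmatrix}0&Y\\Y^*&0\end{pmatrix}\Big|\Big|\Big|_{p,q},$$ where the block matrix is regarded as an element of $M_n\otimes(M_m\otimes M_2)$, that is, $M_n$ remains the first factor and $M_m\otimes M_2$ is the second factor. Let $r\in(0,\infty]$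 be given by $\frac1r=\max\{\frac1p,\frac1q\}-\min\{\frac1p,\frac1q\}$. The Pisier-type norm of $Y\in M_n\otimes M_m$ is, if $p\le q$, $$\|Y\|_{NC}=\sup_{A,B\in M_n\setminus\{0\}}\frac{\|(A\otimes I_m)\,Y\,(B\otimes I_m)\|_p}{\|A\|_{2r}\,\|B\|_{2r}},$$ and, if $p>q$, $$\|Y\|_{NC}=\inf\Big\{\sum_i\|A_i\|_{2r}\,\|B_i\|_{2r}\,\|Z_i\|_p\ :\ Y=\sum_i(A_i\otimes I_m)\,Z_i\,(B_i\otimes I_m)\Big\},$$ the infimum being over all finite families $A_i,B_i\in M_n$, $Z_i\in M_n\otimes M_m$. (A supremum over the empty set, which occurs only for $n=0$, is $0$.) (a) For every positive semidefinite $Y\in M_n\otimes M_m$, $$\|Y\|_{NC}\le\Psi_{p,q}(Y).$$ This bound is sharp: if $Y=Y_1\otimes Y_2$ with $Y_1\in M_n$, $Y_2\in M_m$ is positive semidefinite, then $\|Y\|_{NC}=\Psi_{p,q}(Y)$. (b) For every $Y\in M_n\otimes M_m$, $$\|Y\|_{NC}\le 2^{3-1/p}\,\|Y\|_{CL}.$$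 -/

import Mathlib

open scoped Kronecker ENNReal Matrix ComplexOrder

noncomputable section

namespace BipartiteNorm

variable {ι κ : Type*} [Fintype ι] [DecidableEq ι] [Fintype κ] [DecidableEq κ]

/-- The real power `Y ^ s` of a positive semidefinite matrix (functional calculus). -/
def psdPow (Y : Matrix ι ι ℂ) (s : ℝ) : Matrix ι ι ℂ :=
  cfc (fun x : ℝ => x ^ s) Y

/-- The modulus `|A| = (A* A)^{1/2}`. -/
def modulus (A : Matrix ι ι ℂ) : Matrix ι ι ℂ :=
  cfc Real.sqrt (Aᴴ * A)

/-- The Schatten norm `(Tr |A|^s)^{1/s}` for finite `s`, and the operator norm on the Hilbert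
space `ℂ^ι` for `s = ∞`. -/
def schattenNorm (s : ℝ≥0∞) (A : Matrix ι ι ℂ) : ℝ :=
  if s = ∞ then ‖Matrix.toEuclideanCLM (n := ι) (𝕜 := ℂ) A‖
  else (psdPow (modulus A) s.toReal).trace.re ^ (1 / s.toReal)

/-- The partial trace over the second (inside) tensor factor. -/
def partialTrace₂ (Y : Matrix (ι × κ) (ι × κ) ℂ) : Matrix ι ι ℂ :=
  Matrix.of fun i j => ∑ k, Y (i, k) (j, k)

/-- `Ψ_{p,q}(Y) = (Tr₁ (Tr₂ Y^p)^{q/p})^{1/q}` for positive semidefinite `Y`. -/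
def psi (p q : ℝ) (Y : Matrix (ι × κ) (ι × κ) ℂ) : ℝ :=
  (psdPow (partialTrace₂ (psdPow Y p)) (q / p)).trace.re ^ (1 / q)

/-- `|||X|||_{p,q} = inf {Ψ(A) + Ψ(B) : X + A = B, A ≥ 0, B ≥ 0}` for Hermitian `X`. -/
def tripleNorm (p q : ℝ) (X : Matrix (ι × κ) (ι × κ) ℂ) : ℝ :=
  sInf {t | ∃ A B : Matrix (ι × κ) (ι × κ) ℂ,
    A.PosSemidef ∧ B.PosSemidef ∧ X + A = B ∧ t = psi p q A + psi p q B}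

/-- The Hermitian block matrix with rows `(0, Y)` and `(Y*, 0)`, as an element of
`M_n ⊗ (M_m ⊗ M_2)`. -/
def hermitize (Y : Matrix (ι × κ) (ι × κ) ℂ) :
    Matrix (ι × (κ × Fin 2)) (ι × (κ × Fin 2)) ℂ :=
  Matrix.reindex (Equiv.prodAssoc ι κ (Fin 2)) (Equiv.prodAssoc ι κ (Fin 2))
    (Y ⊗ₖ (!![0, 1; 0, 0] : Matrix (Fin 2) (Fin 2) ℂ)
      + Yᴴ ⊗ₖ (!![0, 0; 1, 0] : Matrix (Fin 2) (Fin 2) ℂ))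

/-- The Carlen–Lieb norm; the inside space is `M_m ⊗ M_2`, the outside space is `M_n`. -/
def clNorm (p q : ℝ) (Y : Matrix (ι × κ) (ι × κ) ℂ) : ℝ :=
  1 / 2 * tripleNorm p q (hermitize Y)

/-- The exponent `r` with `1/r = max(1/p, 1/q) - min(1/p, 1/q)`; it is `∞` if `p = q`. -/
def rExp (p q : ℝ) : ℝ≥0∞ :=
  (ENNReal.ofReal (max (1 / p) (1 / q) - min (1 / p) (1 / q)))⁻¹

/-- The expression for the Pisier-type norm in the case `p ≤ q`. Terms with `A = 0` or `B = 0`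
contribute the value `0` and do not affect the supremum. -/
def ncSup (p q : ℝ) (Y : Matrix (ι × κ) (ι × κ) ℂ) : ℝ≥0∞ :=
  ⨆ (A : Matrix ι ι ℂ) (B : Matrix ι ι ℂ),
    ENNReal.ofReal
      (schattenNorm (ENNReal.ofReal p)
          ((A ⊗ₖ (1 : Matrix κ κ ℂ)) * Y * (B ⊗ₖ (1 : Matrix κ κ ℂ)))
        / (schattenNorm (2 * rExp p q) A * schattenNorm (2 * rExp p q) B))

/-- The expression for the Pisier-type norm in the case `q ≤ p`: an infimum over all finite
decompositions `Y = ∑ i, (A i ⊗ 1) Z i (B i ⊗ 1)`. -/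
def ncInf (p q : ℝ) (Y : Matrix (ι × κ) (ι × κ) ℂ) : ℝ≥0∞ :=
  ⨅ (N : ℕ) (A : Fin N → Matrix ι ι ℂ) (B : Fin N → Matrix ι ι ℂ)
    (Z : Fin N → Matrix (ι × κ) (ι × κ) ℂ)
    (_ : Y = ∑ i, (A i ⊗ₖ (1 : Matrix κ κ ℂ)) * Z i * (B i ⊗ₖ (1 : Matrix κ κ ℂ))),
    ENNReal.ofReal
      (∑ i, schattenNorm (2 * rExp p q) (A i) * schattenNorm (2 * rExp p q) (B i)
        * schattenNorm (ENNReal.ofReal p) (Z i))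

/-- The Pisier-type norm `‖Y‖_NC`. It takes values in `[0, ∞]`, so that no junk value can occur
in the supremum or the infimum; an upper bound on it by a real number includes its finiteness. -/
def ncNorm (p q : ℝ) (Y : Matrix (ι × κ) (ι × κ) ℂ) : ℝ≥0∞ :=
  if p ≤ q then ncSup p q Y else ncInf p q Y

end BipartiteNorm

end

/-!
The proof rests on one interpolation inequality, `norm_trace_interpolation`. For `θ = 1/p`, the
trace of a product of a dual element `w ^ (1 - θ)` and of powers `a ^ θ`, `y ^ θ`, `b ^ θ`,
separated by contractions, is bounded by the three lines theorem: on `Re z = 0` only `w` is not a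
contraction and the trace norm of `w` appears, on `Re z = 1` the Cauchy–Schwarz inequality applies.
Combined with the singular value decomposition it gives the duality and the triangle inequality of
Schatten norms and, for positive `Y`, the inequality `schattenNorm_mul_mul_le`,
`‖A Y B‖_p ≤ (Tr |A|^{2p} Y^p)^{1/2p} (Tr Y^p |B*|^{2p})^{1/2p}`,
a form of Araki–Lieb–Thirring together with Hölder.

Let `T = Tr₂ Y^p`, so that `Ψ(Y)^q = Tr T^{q/p}`. If `p ≤ q`, this inequality for `A ⊗ 1`, `B ⊗ 1`
leaves `Tr |A|^{2p} T`, which Hölder's inequality on the outside space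
(`trace_psdPow_mul_psdPow_le`) bounds by `‖A‖_{2r}^{2p} (Tr T^{q/p})^{p/q}`; this is
`‖Y‖_NC ≤ Ψ(Y)`. If `q < p`, the same inequality bounds the middle factor of the one-term
decomposition `Y = (A ⊗ 1) Z (A ⊗ 1)` with `A = (T + ε)^{q/(2pr)}`, and `ε` tends to `0`.

For `Y = Y₁ ⊗ Y₂` the factors may be taken positive. If `p ≤ q`, equality is attained at a power
of `Y₁` in place of `A` and `B`. If `q < p`, an arbitrary decomposition of `Y` is paired with
`Y₁^{q-1} ⊗ Y₂^{p-1}`, and each term is estimated by the interpolation inequality for the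
conjugate exponent, `norm_trace_mul_mul_mul_le`.

For general `Y`, if the block matrix `H` of `Y` is `B - A` with `A, B ≥ 0`, then `Y` is a corner of
`B - A`. The Pisier-type norm satisfies the triangle inequality and decreases under compressions of
the inside space, so `‖Y‖_NC ≤ Ψ(A) + Ψ(B)`. Thus `‖Y‖_NC ≤ 2 ‖Y‖_CL`, and
`2 ≤ 2^{3 - 1/p}`.
-/

noncomputable section

namespace BipartiteNorm

set_option linter.unusedSectionVars false

variable {ι κ : Type*} [Fintype ι] [DecidableEq ι] [Fintype κ] [DecidableEq κ]

/-! ### Functional calculus in diagonalizations and the singular value decomposition -/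

/-- The diagonal complex matrix with real diagonal `d`. -/
abbrev realDiag (d : ι → ℝ) : Matrix ι ι ℂ := Matrix.diagonal fun i => (d i : ℂ)

theorem realDiag_mul (d e : ι → ℝ) :
    realDiag d * realDiag e = realDiag fun i => d i * e i := by
  simp [realDiag, Matrix.diagonal_mul_diagonal]

theorem conjTranspose_mem_unitaryGroup {U : Matrix ι ι ℂ} (hU : U ∈ Matrix.unitaryGroup ι ℂ) :
    Uᴴ ∈ Matrix.unitaryGroup ι ℂ :=
  Unitary.star_mem hU

theorem trace_conj_unitary {U : Matrix ι ι ℂ} (hU : U ∈ Matrix.unitaryGroup ι ℂ)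
    (D : Matrix ι ι ℂ) : (U * D * Uᴴ).trace = D.trace := by
  rw [Matrix.trace_mul_comm, ← mul_assoc]
  have : Uᴴ * U = 1 := Matrix.mem_unitaryGroup_iff'.1 hU
  rw [this, one_mul]

theorem realDiag_isHermitian (d : ι → ℝ) : (realDiag d).IsHermitian := by
  rw [Matrix.IsHermitian, Matrix.diagonal_conjTranspose]
  congr 1
  ext i
  simp

theorem conj_realDiag_mul {U : Matrix ι ι ℂ} (hU : U ∈ Matrix.unitaryGroup ι ℂ) (d e : ι → ℝ) :
    (U * realDiag d * Uᴴ) * (U * realDiag e * Uᴴ)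
      = U * realDiag (fun i => d i * e i) * Uᴴ := by
  have : Uᴴ * U = 1 := Matrix.mem_unitaryGroup_iff'.1 hU
  calc _ = U * realDiag d * (Uᴴ * U) * realDiag e * Uᴴ := by simp only [mul_assoc]
    _ = _ := by rw [this, mul_one, mul_assoc U, realDiag_mul]

/-- The functional calculus of a Hermitian matrix can be computed in any of its unitary
diagonalizations, since on the finite spectrum every function is a polynomial. -/
theorem cfc_conj_realDiag {U : Matrix ι ι ℂ} (hU : U ∈ Matrix.unitaryGroup ι ℂ)
    (d : ι → ℝ) (f : ℝ → ℝ) :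
    cfc f (U * realDiag d * Uᴴ) = U * realDiag (fun i => f (d i)) * Uᴴ := by
  have hUU' : U * Uᴴ = 1 := Matrix.mem_unitaryGroup_iff.1 hU
  have hsa : IsSelfAdjoint (U * realDiag d * Uᴴ) :=
    Matrix.isHermitian_mul_mul_conjTranspose U (realDiag_isHermitian d)
  have hspec : spectrum ℝ (U * realDiag d * Uᴴ) ⊆ Set.range d := by
    intro x hx
    have h := Unitary.spectrum_star_right_conjugate (R := ℝ) (a := realDiag d)
      (U := (⟨U, hU⟩ : unitary (Matrix ι ι ℂ)))
    rw [← Matrix.star_eq_conjTranspose] at hx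
    have hx' : x ∈ spectrum ℝ (realDiag d) := by
      rw [← h]; exact hx
    have := spectrum.algebraMap_mem ℂ hx'
    rw [spectrum_diagonal] at this
    obtain ⟨i, hi⟩ := this
    exact ⟨i, by simpa using hi⟩
  let P : Polynomial ℝ := Lagrange.interpolate (Finset.univ.image d) id f
  have hP : ∀ i, P.eval (d i) = f (d i) := fun i =>
    Lagrange.eval_interpolate_at_node (s := Finset.univ.image d) (v := id) f
      (Set.injOn_id _) (Finset.mem_image_of_mem d (Finset.mem_univ i))
  have hcongr : cfc f (U * realDiag d * Uᴴ) = cfc P.eval (U * realDiag d * Uᴴ) := by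
    refine cfc_congr fun x hx => ?_
    obtain ⟨i, rfl⟩ := hspec hx
    exact (hP i).symm
  rw [hcongr, cfc_polynomial P _ hsa]
  have key : ∀ Q : Polynomial ℝ, Polynomial.aeval (U * realDiag d * Uᴴ) Q
      = U * realDiag (fun i => Q.eval (d i)) * Uᴴ := by
    intro Q
    induction Q using Polynomial.induction_on' with
    | add p q hp hq =>
      rw [map_add, hp, hq, ← add_mul, ← mul_add, Matrix.diagonal_add]
      simp only [realDiag, Polynomial.eval_add, Complex.ofReal_add]
    | monomial n a =>
      have hpow : ∀ n : ℕ, (U * realDiag d * Uᴴ) ^ n = U * realDiag (fun i => d i ^ n) * Uᴴ := by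
        intro n
        induction n with
        | zero => simp [realDiag, hUU']
        | succ n ih => rw [pow_succ, ih, conj_realDiag_mul hU]; simp [pow_succ]
      rw [Polynomial.aeval_monomial, hpow, ← Algebra.smul_def, ← Matrix.smul_mul,
        ← Matrix.mul_smul]
      congr 2
      ext i j
      by_cases h : i = j <;> simp [h, realDiag]
  rw [key]
  simp_rw [hP]

theorem psdPow_conj_realDiag {U : Matrix ι ι ℂ} (hU : U ∈ Matrix.unitaryGroup ι ℂ)
    (d : ι → ℝ) (s : ℝ) :
    psdPow (U * realDiag d * Uᴴ) s = U * realDiag (fun i => d i ^ s) * Uᴴ :=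
  cfc_conj_realDiag hU d _

theorem exists_unitary_realDiag {Y : Matrix ι ι ℂ} (hY : Y.PosSemidef) :
    ∃ U ∈ Matrix.unitaryGroup ι ℂ, ∃ d : ι → ℝ, (∀ i, 0 ≤ d i) ∧ Y = U * realDiag d * Uᴴ :=
  ⟨hY.1.eigenvectorUnitary, hY.1.eigenvectorUnitary.2, hY.1.eigenvalues, hY.eigenvalues_nonneg,
    hY.1.spectral_theorem⟩

theorem posSemidef_conj_realDiag (U : Matrix κ ι ℂ) {d : ι → ℝ} (hd : ∀ i, 0 ≤ d i) :
    (U * realDiag d * Uᴴ).PosSemidef :=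
  (Matrix.PosSemidef.diagonal fun i => by simpa using hd i).mul_mul_conjTranspose_same U

theorem psdPow_posSemidef {Y : Matrix ι ι ℂ} (hY : Y.PosSemidef) (s : ℝ) :
    (psdPow Y s).PosSemidef := by
  obtain ⟨U, hU, d, hd, rfl⟩ := exists_unitary_realDiag hY
  rw [psdPow_conj_realDiag hU]
  exact posSemidef_conj_realDiag U fun i => Real.rpow_nonneg (hd i) s

theorem psdPow_zero {Y : Matrix ι ι ℂ} (hY : Y.PosSemidef) : psdPow Y 0 = 1 := by
  obtain ⟨U, hU, d, hd, rfl⟩ := exists_unitary_realDiag hY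
  have hUU : U * Uᴴ = 1 := Matrix.mem_unitaryGroup_iff.1 hU
  rw [psdPow_conj_realDiag hU]
  simp [realDiag, hUU]

theorem psdPow_one {Y : Matrix ι ι ℂ} (hY : Y.PosSemidef) : psdPow Y 1 = Y := by
  obtain ⟨U, hU, d, hd, rfl⟩ := exists_unitary_realDiag hY
  rw [psdPow_conj_realDiag hU]
  simp

theorem psdPow_psdPow {Y : Matrix ι ι ℂ} (hY : Y.PosSemidef) (s t : ℝ) :
    psdPow (psdPow Y s) t = psdPow Y (s * t) := by
  obtain ⟨U, hU, d, hd, rfl⟩ := exists_unitary_realDiag hY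
  simp_rw [psdPow_conj_realDiag hU, ← Real.rpow_mul (hd _)]

theorem psdPow_mul_psdPow {Y : Matrix ι ι ℂ} (hY : Y.PosSemidef) {s t : ℝ} (hs : 0 ≤ s)
    (ht : 0 ≤ t) : psdPow Y s * psdPow Y t = psdPow Y (s + t) := by
  obtain ⟨U, hU, d, hd, rfl⟩ := exists_unitary_realDiag hY
  simp_rw [psdPow_conj_realDiag hU, conj_realDiag_mul hU,
    ← Real.rpow_add_of_nonneg (hd _) hs ht]

theorem kronecker_mem_unitaryGroup {U : Matrix ι ι ℂ} {V : Matrix κ κ ℂ}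
    (hU : U ∈ Matrix.unitaryGroup ι ℂ) (hV : V ∈ Matrix.unitaryGroup κ ℂ) :
    U ⊗ₖ V ∈ Matrix.unitaryGroup (ι × κ) ℂ := Matrix.kronecker_mem_unitary hU hV

theorem psdPow_kronecker {Y : Matrix ι ι ℂ} {Z : Matrix κ κ ℂ} (hY : Y.PosSemidef)
    (hZ : Z.PosSemidef) (s : ℝ) : psdPow (Y ⊗ₖ Z) s = psdPow Y s ⊗ₖ psdPow Z s := by
  obtain ⟨U, hU, d, hd, rfl⟩ := exists_unitary_realDiag hY
  obtain ⟨V, hV, e, he, rfl⟩ := exists_unitary_realDiag hZ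
  have h : ∀ (d : ι → ℝ) (e : κ → ℝ), (U * realDiag d * Uᴴ) ⊗ₖ (V * realDiag e * Vᴴ)
      = (U ⊗ₖ V) * realDiag (fun x : ι × κ => d x.1 * e x.2) * (U ⊗ₖ V)ᴴ := by
    intro d e
    rw [Matrix.mul_kronecker_mul, Matrix.mul_kronecker_mul, Matrix.conjTranspose_kronecker,
      Matrix.diagonal_kronecker_diagonal]
    simp [realDiag]
  rw [h, psdPow_conj_realDiag (kronecker_mem_unitaryGroup hU hV), psdPow_conj_realDiag hU,
    psdPow_conj_realDiag hV, h]
  simp_rw [Real.mul_rpow (hd _) (he _)]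

theorem psdPow_one_matrix (s : ℝ) : psdPow (1 : Matrix ι ι ℂ) s = 1 := by
  have h := psdPow_conj_realDiag (one_mem (Matrix.unitaryGroup ι ℂ)) (fun _ => 1) s
  simpa [realDiag] using h

theorem trace_psdPow {U : Matrix ι ι ℂ} (hU : U ∈ Matrix.unitaryGroup ι ℂ)
    (d : ι → ℝ) (s : ℝ) :
    (psdPow (U * realDiag d * Uᴴ) s).trace = ((∑ i, d i ^ s : ℝ) : ℂ) := by
  rw [psdPow_conj_realDiag hU, trace_conj_unitary hU]
  simp [Matrix.trace_diagonal]

theorem trace_re_nonneg {Y : Matrix ι ι ℂ} (hY : Y.PosSemidef) : 0 ≤ Y.trace.re :=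
  (Complex.nonneg_iff.1 hY.trace_nonneg).1

theorem trace_eq_re {Y : Matrix ι ι ℂ} (hY : Y.PosSemidef) : Y.trace = (Y.trace.re : ℂ) :=
  Complex.eq_re_of_ofReal_le (r := 0) (by simpa using hY.trace_nonneg)

theorem modulus_psdPow (A : Matrix ι ι ℂ) (s : ℝ) :
    psdPow (modulus A) s = psdPow (Aᴴ * A) (s / 2) := by
  obtain ⟨U, hU, d, hd, h⟩ := exists_unitary_realDiag (Matrix.posSemidef_conjTranspose_mul_self A)
  rw [modulus, h, cfc_conj_realDiag hU, psdPow_conj_realDiag hU, psdPow_conj_realDiag hU]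
  simp_rw [Real.sqrt_eq_rpow, ← Real.rpow_mul (hd _)]
  ring_nf

theorem schattenNorm_ofReal {s : ℝ} (hs : 0 ≤ s) (A : Matrix ι ι ℂ) :
    schattenNorm (ENNReal.ofReal s) A = (psdPow (Aᴴ * A) (s / 2)).trace.re ^ (1 / s) := by
  rw [schattenNorm, if_neg ENNReal.ofReal_ne_top, ENNReal.toReal_ofReal hs, modulus_psdPow]

theorem schattenNorm_of_posSemidef {s : ℝ} (hs : 0 ≤ s) {Y : Matrix ι ι ℂ} (hY : Y.PosSemidef) :
    schattenNorm (ENNReal.ofReal s) Y = (psdPow Y s).trace.re ^ (1 / s) := by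
  have h : Yᴴ * Y = psdPow Y 2 := by
    rw [hY.1, ← one_add_one_eq_two, ← psdPow_mul_psdPow hY zero_le_one zero_le_one, psdPow_one hY]
  rw [schattenNorm_ofReal hs, h, psdPow_psdPow hY, mul_div_cancel₀ _ two_ne_zero]

/-- Singular value decomposition of a square complex matrix. -/
theorem exists_singularValueDecomposition (X : Matrix ι ι ℂ) :
    ∃ U ∈ Matrix.unitaryGroup ι ℂ, ∃ V ∈ Matrix.unitaryGroup ι ℂ, ∃ s : ι → ℝ,
      (∀ i, 0 ≤ s i) ∧ X = U * realDiag s * V := by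
  obtain ⟨V, hV, d, hd, h⟩ := exists_unitary_realDiag (Matrix.posSemidef_conjTranspose_mul_self X)
  have hVV : Vᴴ * V = 1 := Matrix.mem_unitaryGroup_iff'.1 hV
  have hVV' : V * Vᴴ = 1 := Matrix.mem_unitaryGroup_iff.1 hV
  have hXV : (X * V)ᴴ * (X * V) = realDiag d := by
    rw [Matrix.conjTranspose_mul]
    calc _ = Vᴴ * (Xᴴ * X) * V := by simp only [mul_assoc]
      _ = (Vᴴ * V) * realDiag d * (Vᴴ * V) := by rw [h]; simp only [mul_assoc]
      _ = _ := by rw [hVV]; simp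
  let s : ι → ℝ := fun i => √(d i)
  -- normalized columns of `X * V`
  let v : ι → EuclideanSpace ℂ ι := fun j =>
    WithLp.toLp 2 fun i => ((s j)⁻¹ : ℂ) * (X * V) i j
  have hinner : ∀ i j, inner ℂ (v i) (v j) = ((s i)⁻¹ : ℂ) * (s j)⁻¹ * realDiag d i j := by
    intro i j
    rw [← hXV, Matrix.mul_apply, Finset.mul_sum]
    simp only [v, PiLp.inner_apply, RCLike.inner_apply, Matrix.conjTranspose_apply]
    refine Finset.sum_congr rfl fun k _ => ?_
    simp
    ring
  let S : Set ι := {i | d i ≠ 0}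
  have hon : Orthonormal ℂ (S.domRestrict v) := by
    rw [orthonormal_iff_ite]
    rintro ⟨i, hi⟩ ⟨j, hj⟩
    change inner ℂ (v i) (v j) = _
    simp only [hinner, Subtype.mk.injEq]
    by_cases hij : i = j
    · subst hij
      have h1 : s i * s i = d i := Real.mul_self_sqrt (hd i)
      have h2 : (d i : ℂ) ≠ 0 := by exact_mod_cast hi
      simp only [realDiag, Matrix.diagonal_apply_eq, if_true]
      rw [Complex.ofReal_inv, ← mul_inv, ← Complex.ofReal_mul, h1, inv_mul_cancel₀ h2]
    · simp [hij, realDiag]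
  obtain ⟨b, hb⟩ := hon.exists_orthonormalBasis_extension_of_card_eq (by simp)
  let U : Matrix ι ι ℂ := Matrix.of fun i j => b j i
  have hU : U ∈ Matrix.unitaryGroup ι ℂ := by
    rw [Matrix.mem_unitaryGroup_iff']
    ext i j
    have := orthonormal_iff_ite.1 b.orthonormal i j
    rw [PiLp.inner_apply] at this
    simp only [RCLike.inner_apply] at this
    rw [Matrix.mul_apply, Matrix.one_apply, ← this]
    refine Finset.sum_congr rfl fun k _ => ?_
    simp [U, mul_comm]
  refine ⟨U, hU, Vᴴ, conjTranspose_mem_unitaryGroup hV, s, fun i => Real.sqrt_nonneg _, ?_⟩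
  have hUs : X * V = U * realDiag s := by
    ext i j
    rw [Matrix.mul_diagonal]
    by_cases hj : d j = 0
    · have h0 : ∑ k, star ((X * V) k j) * (X * V) k j = 0 := by
        have := congrFun (congrFun hXV j) j
        rw [Matrix.mul_apply] at this
        simpa [realDiag, hj] using this
      have h1 := (Finset.sum_eq_zero_iff_of_nonneg
        (fun k _ => star_mul_self_nonneg ((X * V) k j))).1 h0 i (Finset.mem_univ i)
      have h2 : (X * V) i j = 0 := by simpa using h1
      rw [h2]
      simp [s, hj]
    · have h1 : b j i = ((s j)⁻¹ : ℂ) * (X * V) i j := by rw [hb j hj]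
      have h2 : (s j : ℂ) ≠ 0 := by
        exact_mod_cast (Real.sqrt_pos.2 (lt_of_le_of_ne (hd j) (Ne.symm hj))).ne'
      simp only [U, Matrix.of_apply, h1]
      field_simp
  rw [← hUs, mul_assoc, hVV', mul_one]

theorem conjTranspose_mul_self_svd {U V : Matrix ι ι ℂ} (hU : U ∈ Matrix.unitaryGroup ι ℂ)
    (s : ι → ℝ) :
    (U * realDiag s * V)ᴴ * (U * realDiag s * V)
      = Vᴴ * realDiag (fun i => s i ^ 2) * Vᴴᴴ := by
  have hUU : Uᴴ * U = 1 := Matrix.mem_unitaryGroup_iff'.1 hU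
  have h := realDiag_isHermitian s
  rw [Matrix.IsHermitian] at h
  rw [Matrix.conjTranspose_mul, Matrix.conjTranspose_mul, h, Matrix.conjTranspose_conjTranspose]
  calc _ = Vᴴ * (realDiag s * (Uᴴ * U) * realDiag s) * V := by simp only [mul_assoc]
    _ = _ := by rw [hUU, mul_one, realDiag_mul]; simp only [sq]

theorem self_mul_conjTranspose_svd {U V : Matrix ι ι ℂ} (hV : V ∈ Matrix.unitaryGroup ι ℂ)
    (s : ι → ℝ) :
    (U * realDiag s * V) * (U * realDiag s * V)ᴴ
      = U * realDiag (fun i => s i ^ 2) * Uᴴ := by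
  have hVV : V * Vᴴ = 1 := Matrix.mem_unitaryGroup_iff.1 hV
  have h := realDiag_isHermitian s
  rw [Matrix.IsHermitian] at h
  rw [Matrix.conjTranspose_mul, Matrix.conjTranspose_mul, h]
  calc _ = U * (realDiag s * (V * Vᴴ) * realDiag s) * Uᴴ := by simp only [mul_assoc]
    _ = _ := by rw [hVV, mul_one, realDiag_mul]; simp only [sq]

theorem psdPow_conjTranspose_mul_self_svd {U V : Matrix ι ι ℂ}
    (hU : U ∈ Matrix.unitaryGroup ι ℂ) (hV : V ∈ Matrix.unitaryGroup ι ℂ) {s : ι → ℝ}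
    (hs : ∀ i, 0 ≤ s i) (t : ℝ) :
    psdPow ((U * realDiag s * V)ᴴ * (U * realDiag s * V)) t
      = Vᴴ * realDiag (fun i => s i ^ (2 * t)) * V := by
  rw [conjTranspose_mul_self_svd hU,
    psdPow_conj_realDiag (conjTranspose_mem_unitaryGroup hV),
    Matrix.conjTranspose_conjTranspose]
  simp_rw [← Real.rpow_natCast, ← Real.rpow_mul (hs _)]
  norm_num

theorem psdPow_self_mul_conjTranspose_svd {U V : Matrix ι ι ℂ}
    (hU : U ∈ Matrix.unitaryGroup ι ℂ) (hV : V ∈ Matrix.unitaryGroup ι ℂ) {s : ι → ℝ}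
    (hs : ∀ i, 0 ≤ s i) (t : ℝ) :
    psdPow ((U * realDiag s * V) * (U * realDiag s * V)ᴴ) t
      = U * realDiag (fun i => s i ^ (2 * t)) * Uᴴ := by
  rw [self_mul_conjTranspose_svd hV, psdPow_conj_realDiag hU]
  simp_rw [← Real.rpow_natCast, ← Real.rpow_mul (hs _)]
  norm_num

theorem trace_psdPow_conjTranspose_mul_self_svd {U V : Matrix ι ι ℂ}
    (hU : U ∈ Matrix.unitaryGroup ι ℂ) (hV : V ∈ Matrix.unitaryGroup ι ℂ) {s : ι → ℝ}
    (hs : ∀ i, 0 ≤ s i) (t : ℝ) :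
    (psdPow ((U * realDiag s * V)ᴴ * (U * realDiag s * V)) t).trace.re = ∑ i, s i ^ (2 * t) := by
  have := trace_conj_unitary (conjTranspose_mem_unitaryGroup hV)
    (realDiag (fun i => s i ^ (2 * t)))
  rw [Matrix.conjTranspose_conjTranspose] at this
  rw [psdPow_conjTranspose_mul_self_svd hU hV hs, this]
  simp [Matrix.trace_diagonal]

theorem trace_psdPow_self_mul_conjTranspose (A : Matrix ι ι ℂ) (t : ℝ) :
    (psdPow (A * Aᴴ) t).trace = (psdPow (Aᴴ * A) t).trace := by
  obtain ⟨U, hU, V, hV, s, hs, rfl⟩ := exists_singularValueDecomposition A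
  have := trace_conj_unitary (conjTranspose_mem_unitaryGroup hV)
    (realDiag (fun i => s i ^ (2 * t)))
  rw [Matrix.conjTranspose_conjTranspose] at this
  rw [psdPow_conjTranspose_mul_self_svd hU hV hs, psdPow_self_mul_conjTranspose_svd hU hV hs, this,
    trace_conj_unitary hU]

theorem schattenNorm_svd {p : ℝ} (hp : 0 ≤ p) {U V : Matrix ι ι ℂ}
    (hU : U ∈ Matrix.unitaryGroup ι ℂ) (hV : V ∈ Matrix.unitaryGroup ι ℂ) {s : ι → ℝ}
    (hs : ∀ i, 0 ≤ s i) :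
    schattenNorm (ENNReal.ofReal p) (U * realDiag s * V) = (∑ i, s i ^ p) ^ (1 / p) := by
  rw [schattenNorm_ofReal hp, trace_psdPow_conjTranspose_mul_self_svd hU hV hs,
    mul_div_cancel₀ _ two_ne_zero]

/-! ### Interpolation of traces by the three lines theorem -/

section ThreeLines

open scoped Matrix.Norms.L2Operator

variable {α β γ : Type*} [Fintype α] [DecidableEq α] [Fintype β] [DecidableEq β]
  [Fintype γ] [DecidableEq γ]

/-- The sum of the squared moduli of the entries (the square of the Hilbert–Schmidt norm). -/
def hsSq (X : Matrix ι κ ℂ) : ℝ := ∑ i, ∑ j, ‖X i j‖ ^ 2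

theorem norm_trace_mul_le (P : Matrix ι κ ℂ) (Q : Matrix κ ι ℂ) :
    ‖(P * Q).trace‖ ≤ √(hsSq P) * √(hsSq Q) := by
  have h1 : ‖(P * Q).trace‖ ≤ ∑ x : ι × κ, ‖P x.1 x.2‖ * ‖Q x.2 x.1‖ := by
    rw [Matrix.trace, Fintype.sum_prod_type]
    refine (norm_sum_le _ _).trans (Finset.sum_le_sum fun i _ => ?_)
    rw [Matrix.diag_apply, Matrix.mul_apply]
    exact (norm_sum_le _ _).trans_eq (by simp)
  refine h1.trans ((Real.sum_mul_le_sqrt_mul_sqrt _ _ _).trans_eq ?_)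
  congr 2
  · rw [Fintype.sum_prod_type, hsSq]
  · rw [Fintype.sum_prod_type_right, hsSq]

theorem hsSq_mul_le (G : Matrix α ι ℂ) (hG : ‖G‖ ≤ 1) (P : Matrix ι κ ℂ) :
    hsSq (G * P) ≤ hsSq P := by
  rw [hsSq, hsSq, Finset.sum_comm, Finset.sum_comm (γ := ι)]
  refine Finset.sum_le_sum fun j _ => ?_
  have h := Matrix.l2_opNorm_mulVec G (WithLp.toLp 2 fun i => P i j)
  have h2 : ‖(WithLp.toLp 2 (G *ᵥ fun i => P i j) : EuclideanSpace ℂ α)‖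
      ≤ ‖(WithLp.toLp 2 fun i => P i j : EuclideanSpace ℂ ι)‖ :=
    h.trans (mul_le_of_le_one_left (norm_nonneg _) hG)
  have h3 := pow_le_pow_left₀ (norm_nonneg _) h2 2
  rw [EuclideanSpace.norm_sq_eq, EuclideanSpace.norm_sq_eq] at h3
  exact h3

theorem norm_entry_le (C : Matrix ι κ ℂ) (i : ι) (j : κ) : ‖C i j‖ ≤ ‖C‖ := by
  have h := Matrix.l2_opNorm_mulVec C (EuclideanSpace.single j 1)
  have h2 := PiLp.norm_apply_le (WithLp.toLp 2 (C *ᵥ Pi.single j 1) : EuclideanSpace ℂ ι) i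
  rw [EuclideanSpace.single, PiLp.norm_single, norm_one, mul_one] at h
  refine le_trans (le_of_eq ?_) (h2.trans h)
  simp

theorem norm_mul_le_one {G : Matrix α β ℂ} {H : Matrix β γ ℂ} (hG : ‖G‖ ≤ 1) (hH : ‖H‖ ≤ 1) :
    ‖G * H‖ ≤ 1 :=
  (Matrix.l2_opNorm_mul G H).trans (mul_le_one₀ hG (norm_nonneg _) hH)

theorem norm_diagonal_le_one {d : ι → ℂ} (hd : ∀ i, ‖d i‖ ≤ 1) :
    ‖(Matrix.diagonal d : Matrix ι ι ℂ)‖ ≤ 1 := by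
  rw [Matrix.l2_opNorm_diagonal]
  exact (pi_norm_le_iff_of_nonneg zero_le_one).2 hd

theorem norm_unitary_le_one {U : Matrix ι ι ℂ} (hU : U ∈ Matrix.unitaryGroup ι ℂ) : ‖U‖ ≤ 1 := by
  have h := CStarRing.norm_star_mul_self (x := U)
  rw [Matrix.mem_unitaryGroup_iff'.1 hU] at h
  have h1 : ‖(1 : Matrix ι ι ℂ)‖ ≤ 1 := by
    rw [← Matrix.diagonal_one]
    exact norm_diagonal_le_one fun i => by simp
  nlinarith [norm_nonneg U]

theorem norm_trace_diagonal_mul_le (d : ι → ℂ) {C : Matrix ι ι ℂ} (hC : ‖C‖ ≤ 1) :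
    ‖(Matrix.diagonal d * C).trace‖ ≤ ∑ i, ‖d i‖ := by
  rw [Matrix.trace]
  refine (norm_sum_le _ _).trans (Finset.sum_le_sum fun i _ => ?_)
  rw [Matrix.diag_apply, Matrix.diagonal_mul, norm_mul]
  exact mul_le_of_le_one_right (norm_nonneg _) ((norm_entry_le C i i).trans hC)

/-- Cauchy–Schwarz for the Hilbert–Schmidt inner product, after splitting the middle diagonal
matrix into two square roots. -/
theorem norm_trace_diagonal_chain_le (w : ι → ℂ) (hw : ∀ i, ‖w i‖ ≤ 1) (a : α → ℂ) (y : β → ℂ)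
    (b : γ → ℂ) {E₁ : Matrix ι α ℂ} {E₄ : Matrix γ ι ℂ} (h₁ : ‖E₁‖ ≤ 1) (h₄ : ‖E₄‖ ≤ 1)
    (E₂ : Matrix α β ℂ) (E₃ : Matrix β γ ℂ) :
    ‖(Matrix.diagonal w * (E₁ * Matrix.diagonal a * E₂ * Matrix.diagonal y * E₃ *
        Matrix.diagonal b * E₄)).trace‖
      ≤ √(∑ i, ∑ j, ‖a i‖ ^ 2 * ‖E₂ i j‖ ^ 2 * ‖y j‖)
        * √(∑ j, ∑ k, ‖y j‖ * ‖E₃ j k‖ ^ 2 * ‖b k‖ ^ 2) := by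
  let y₁ : β → ℂ := fun j => (√‖y j‖ : ℝ)
  let y₂ : β → ℂ := fun j => y j / (√‖y j‖ : ℝ)
  have hy : Matrix.diagonal y = Matrix.diagonal y₁ * Matrix.diagonal y₂ := by
    rw [Matrix.diagonal_mul_diagonal]
    congr 1
    ext j
    by_cases h : y j = 0
    · simp [y₁, y₂, h]
    · have : ((√‖y j‖ : ℝ) : ℂ) ≠ 0 := by
        exact_mod_cast (Real.sqrt_pos.2 (norm_pos_iff.2 h)).ne'
      simp only [y₁, y₂]
      field_simp
  have hy₁ : ∀ j, ‖y₁ j‖ ^ 2 = ‖y j‖ := fun j => by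
    simp [y₁, abs_of_nonneg (Real.sqrt_nonneg _)]
  have hy₂ : ∀ j, ‖y₂ j‖ ^ 2 = ‖y j‖ := fun j => by
    by_cases h : y j = 0
    · simp [y₂, h]
    · have h' := norm_pos_iff.2 h
      simp only [y₂, norm_div, div_pow, Complex.norm_real, Real.norm_eq_abs, sq_abs,
        Real.sq_sqrt (norm_nonneg _)]
      field_simp
  let G : Matrix γ α ℂ := E₄ * Matrix.diagonal w * E₁
  have hG : ‖G‖ ≤ 1 := norm_mul_le_one (norm_mul_le_one h₄ (norm_diagonal_le_one hw)) h₁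
  let P : Matrix α β ℂ := Matrix.diagonal a * E₂ * Matrix.diagonal y₁
  let Q : Matrix β γ ℂ := Matrix.diagonal y₂ * E₃ * Matrix.diagonal b
  have htr : (Matrix.diagonal w * (E₁ * Matrix.diagonal a * E₂ * Matrix.diagonal y * E₃ *
        Matrix.diagonal b * E₄)).trace = ((G * P) * Q).trace := by
    rw [hy]
    calc _ = ((Matrix.diagonal w * E₁ * P * Q) * E₄).trace := by simp only [P, Q, Matrix.mul_assoc]
      _ = (E₄ * (Matrix.diagonal w * E₁ * P * Q)).trace := Matrix.trace_mul_comm _ _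
      _ = _ := by simp only [G, Matrix.mul_assoc]
  rw [htr]
  refine (norm_trace_mul_le _ _).trans ?_
  have hP : hsSq P = ∑ i, ∑ j, ‖a i‖ ^ 2 * ‖E₂ i j‖ ^ 2 * ‖y j‖ := by
    refine Finset.sum_congr rfl fun i _ => Finset.sum_congr rfl fun j _ => ?_
    simp only [P, Matrix.mul_diagonal, Matrix.diagonal_mul, norm_mul, mul_pow, hy₁]
  have hQ : hsSq Q = ∑ j, ∑ k, ‖y j‖ * ‖E₃ j k‖ ^ 2 * ‖b k‖ ^ 2 := by
    refine Finset.sum_congr rfl fun i _ => Finset.sum_congr rfl fun j _ => ?_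
    simp only [Q, Matrix.mul_diagonal, Matrix.diagonal_mul, norm_mul, mul_pow, hy₂]
  rw [← hP, ← hQ]
  gcongr
  exact hsSq_mul_le G hG P

/-- The power `d ^ z` of a nonnegative real `d`, with the convention that every power of `0`
is `0`; unlike `Complex.cpow`, it is entire in `z` for `d = 0` too. -/
def realCpow (d : ℝ) (z : ℂ) : ℂ := if d = 0 then 0 else Complex.exp (z * (Real.log d : ℂ))

theorem norm_realCpow_le_one {d : ℝ} {z : ℂ} (hz : z.re = 0) : ‖realCpow d z‖ ≤ 1 := by
  unfold realCpow
  split_ifs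
  · simp
  · simp [Complex.norm_exp, hz]

theorem norm_realCpow_of_re_eq_one {d : ℝ} (hd : 0 ≤ d) {z : ℂ} (hz : z.re = 1) :
    ‖realCpow d z‖ = d := by
  unfold realCpow
  split_ifs with h
  · simp [h]
  · simp [Complex.norm_exp, hz, Real.exp_log (lt_of_le_of_ne hd (Ne.symm h))]

theorem realCpow_ofReal {d : ℝ} (hd : 0 ≤ d) {t : ℝ} (ht : t ≠ 0) :
    realCpow d t = ((d ^ t : ℝ) : ℂ) := by
  unfold realCpow
  split_ifs with h
  · simp [h, Real.zero_rpow ht]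
  · rw [Real.rpow_def_of_pos (lt_of_le_of_ne hd (Ne.symm h)), mul_comm (Real.log d)]
    push_cast
    rfl

/-- Entire functions that are bounded on the strip `0 ≤ Re z ≤ 1`. -/
def StripBounded (f : ℂ → ℂ) : Prop :=
  Differentiable ℂ f ∧ ∃ C : ℝ, ∀ z : ℂ, 0 ≤ z.re → z.re ≤ 1 → ‖f z‖ ≤ C

theorem stripBounded_const (c : ℂ) : StripBounded fun _ => c :=
  ⟨differentiable_const c, ‖c‖, fun _ _ _ => le_rfl⟩

theorem StripBounded.mul {f g : ℂ → ℂ} (hf : StripBounded f) (hg : StripBounded g) :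
    StripBounded fun z => f z * g z := by
  obtain ⟨hf, C, hC⟩ := hf
  obtain ⟨hg, D, hD⟩ := hg
  refine ⟨hf.mul hg, C * D, fun z h0 h1 => ?_⟩
  rw [norm_mul]
  exact mul_le_mul (hC z h0 h1) (hD z h0 h1) (norm_nonneg _) ((norm_nonneg _).trans (hC z h0 h1))

theorem StripBounded.sum {σ : Type*} (s : Finset σ) {f : σ → ℂ → ℂ}
    (hf : ∀ i, StripBounded (f i)) : StripBounded fun z => ∑ i ∈ s, f i z := by
  choose hd C hC using hf
  refine ⟨Differentiable.fun_sum fun i _ => hd i, ∑ i ∈ s, C i, fun z h0 h1 => ?_⟩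
  exact (norm_sum_le _ _).trans (Finset.sum_le_sum fun i _ => hC i z h0 h1)

theorem stripBounded_realCpow (d : ℝ) : StripBounded (realCpow d) := by
  by_cases h : d = 0
  · convert stripBounded_const 0 using 2
    simp [realCpow, h]
  · refine ⟨?_, Real.exp |Real.log d|, fun z h0 h1 => ?_⟩
    · unfold realCpow
      simp only [h, if_false]
      fun_prop
    · simp only [realCpow, h, if_false, Complex.norm_exp]
      refine Real.exp_le_exp.2 ?_
      rw [Complex.re_mul_ofReal]
      refine (le_abs_self _).trans ?_
      rw [abs_mul, abs_of_nonneg h0]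
      exact mul_le_of_le_one_left (abs_nonneg _) h1

theorem StripBounded.one_sub {f : ℂ → ℂ} (hf : StripBounded f) :
    StripBounded fun z => f (1 - z) := by
  obtain ⟨hf, C, hC⟩ := hf
  refine ⟨hf.comp (by fun_prop), C, fun z h0 h1 => hC _ ?_ ?_⟩ <;> simp <;> linarith

theorem stripBounded_mul_matrix {F : ℂ → Matrix α β ℂ} {G : ℂ → Matrix β γ ℂ}
    (hF : ∀ i j, StripBounded fun z => F z i j) (hG : ∀ i j, StripBounded fun z => G z i j)
    (i : α) (k : γ) : StripBounded fun z => (F z * G z) i k := by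
  simp only [Matrix.mul_apply]
  exact StripBounded.sum _ fun j => (hF i j).mul (hG j k)

theorem stripBounded_diagonal {d : ι → ℂ → ℂ} (hd : ∀ i, StripBounded (d i)) (i j : ι) :
    StripBounded fun z => (Matrix.diagonal fun k => d k z : Matrix ι ι ℂ) i j := by
  by_cases h : i = j
  · subst h
    simpa using hd i
  · simpa [h] using stripBounded_const 0

theorem StripBounded.norm_le_of_three_lines {f : ℂ → ℂ} (hf : StripBounded f) {a b : ℝ}
    (ha : ∀ z : ℂ, z.re = 0 → ‖f z‖ ≤ a) (hb : ∀ z : ℂ, z.re = 1 → ‖f z‖ ≤ b) {θ : ℝ}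
    (h0 : 0 ≤ θ) (h1 : θ ≤ 1) : ‖f θ‖ ≤ a ^ (1 - θ) * b ^ θ := by
  obtain ⟨hf, C, hC⟩ := hf
  have h := Complex.HadamardThreeLines.norm_le_interp_of_mem_verticalClosedStrip' (f := f)
    (z := (θ : ℂ)) (a := a) (b := b) zero_lt_one ⟨by simpa using h0, by simpa using h1⟩
    hf.diffContOnCl ⟨C, by rintro _ ⟨z, hz, rfl⟩; exact hC z hz.1 hz.2⟩
    (fun z hz => ha z hz) (fun z hz => hb z hz)
  simpa using h

/-- The interpolation inequality from which Hölder's inequality, duality and the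
Araki–Lieb–Thirring inequality follow: with `θ = 1/p`, the three lines theorem is applied to the
trace with exponents `1 - z` and `z` in place of `1 - θ` and `θ`. On `Re z = 0` all factors but the
first are contractions; on `Re z = 1` the first one is, and Cauchy–Schwarz applies to the rest. -/
theorem norm_trace_interpolation {θ : ℝ} (h0 : 0 < θ) (h1 : θ ≤ 1)
    {w : ι → ℝ} (hw : ∀ i, 0 ≤ w i) {a : α → ℝ} (ha : ∀ i, 0 ≤ a i)
    {y : β → ℝ} (hy : ∀ i, 0 ≤ y i) {b : γ → ℝ} (hb : ∀ i, 0 ≤ b i)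
    {E₁ : Matrix ι α ℂ} {E₂ : Matrix α β ℂ} {E₃ : Matrix β γ ℂ} {E₄ : Matrix γ ι ℂ}
    (h₁ : ‖E₁‖ ≤ 1) (h₂ : ‖E₂‖ ≤ 1) (h₃ : ‖E₃‖ ≤ 1) (h₄ : ‖E₄‖ ≤ 1) :
    ‖(realDiag (fun i => w i ^ (1 - θ)) * (E₁ * realDiag (fun i => a i ^ θ) * E₂ *
        realDiag (fun i => y i ^ θ) * E₃ * realDiag (fun i => b i ^ θ) * E₄)).trace‖
      ≤ (∑ i, w i) ^ (1 - θ) * (√(∑ i, ∑ j, a i ^ 2 * ‖E₂ i j‖ ^ 2 * y j)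
        * √(∑ j, ∑ k, y j * ‖E₃ j k‖ ^ 2 * b k ^ 2)) ^ θ := by
  rcases h1.eq_or_lt with rfl | h1
  · -- here `w i ^ 0 = 1`, also where `w i = 0`
    have := norm_trace_diagonal_chain_le (fun _ : ι => (1 : ℂ)) (by simp) (fun i => (a i : ℂ))
      (fun i => (y i : ℂ)) (fun i => (b i : ℂ)) h₁ h₄ E₂ E₃
    simpa [realDiag, abs_of_nonneg (hy _)] using this
  let f : ℂ → ℂ := fun z => (Matrix.diagonal (fun i => realCpow (w i) (1 - z)) *
    (E₁ * Matrix.diagonal (fun i => realCpow (a i) z) * E₂ *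
      Matrix.diagonal (fun i => realCpow (y i) z) * E₃ *
      Matrix.diagonal (fun i => realCpow (b i) z) * E₄)).trace
  have hf : StripBounded f := by
    refine StripBounded.sum _ fun i => ?_
    refine stripBounded_mul_matrix
      (stripBounded_diagonal fun i => (stripBounded_realCpow _).one_sub) ?_ i i
    refine stripBounded_mul_matrix ?_ fun i j => stripBounded_const (E₄ i j)
    refine stripBounded_mul_matrix ?_ (stripBounded_diagonal fun i => stripBounded_realCpow _)
    refine stripBounded_mul_matrix ?_ fun i j => stripBounded_const (E₃ i j)
    refine stripBounded_mul_matrix ?_ (stripBounded_diagonal fun i => stripBounded_realCpow _)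
    refine stripBounded_mul_matrix ?_ fun i j => stripBounded_const (E₂ i j)
    exact stripBounded_mul_matrix (fun i j => stripBounded_const (E₁ i j))
      (stripBounded_diagonal fun i => stripBounded_realCpow _)
  have hf0 : ∀ z : ℂ, z.re = 0 → ‖f z‖ ≤ ∑ i, w i := by
    intro z hz
    refine (norm_trace_diagonal_mul_le _ ?_).trans_eq ?_
    · refine norm_mul_le_one (norm_mul_le_one (norm_mul_le_one (norm_mul_le_one
        (norm_mul_le_one (norm_mul_le_one h₁ ?_) h₂) ?_) h₃) ?_) h₄ <;>
      exact norm_diagonal_le_one fun i => norm_realCpow_le_one hz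
    · exact Finset.sum_congr rfl fun i _ => norm_realCpow_of_re_eq_one (hw i) (by simp [hz])
  have hf1 : ∀ z : ℂ, z.re = 1 → ‖f z‖ ≤ √(∑ i, ∑ j, a i ^ 2 * ‖E₂ i j‖ ^ 2 * y j)
        * √(∑ j, ∑ k, y j * ‖E₃ j k‖ ^ 2 * b k ^ 2) := by
    intro z hz
    refine (norm_trace_diagonal_chain_le _ (fun i => norm_realCpow_le_one (by simp [hz]))
      _ _ _ h₁ h₄ E₂ E₃).trans_eq ?_
    simp only [norm_realCpow_of_re_eq_one (ha _) hz, norm_realCpow_of_re_eq_one (hy _) hz,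
      norm_realCpow_of_re_eq_one (hb _) hz]
  have h := hf.norm_le_of_three_lines hf0 hf1 h0.le h1.le
  have hθ : (1 - θ : ℂ) = ((1 - θ : ℝ) : ℂ) := by push_cast; rfl
  simpa only [f, hθ, realCpow_ofReal (hw _) (sub_pos.2 h1).ne', realCpow_ofReal (ha _) h0.ne',
    realCpow_ofReal (hy _) h0.ne', realCpow_ofReal (hb _) h0.ne'] using h

end ThreeLines

/-! ### Hölder's inequality, duality and the Araki–Lieb–Thirring inequality -/

theorem trace_conj_mul_conj (U : Matrix ι κ ℂ) (V : Matrix ι ι ℂ) (d : κ → ℝ) (e : ι → ℝ) :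
    (U * realDiag d * Uᴴ * (V * realDiag e * Vᴴ)).trace
      = ((∑ i, ∑ j, d i * ‖(Uᴴ * V) i j‖ ^ 2 * e j : ℝ) : ℂ) := by
  have h : (U * realDiag d * Uᴴ * (V * realDiag e * Vᴴ)).trace
      = (realDiag d * (Uᴴ * V) * realDiag e * (Uᴴ * V)ᴴ).trace := by
    rw [Matrix.conjTranspose_mul, Matrix.conjTranspose_conjTranspose]
    calc _ = (U * (realDiag d * Uᴴ * V * realDiag e * Vᴴ)).trace := by simp only [Matrix.mul_assoc]
      _ = _ := by rw [Matrix.trace_mul_comm]; simp only [Matrix.mul_assoc]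
  rw [h, Matrix.trace]
  push_cast
  refine Finset.sum_congr rfl fun i _ => ?_
  rw [Matrix.diag_apply, Matrix.mul_apply]
  refine Finset.sum_congr rfl fun j _ => ?_
  rw [Matrix.mul_diagonal, Matrix.diagonal_mul, Matrix.conjTranspose_apply, Complex.star_def,
    ← Complex.mul_conj']
  ring

theorem sum_norm_sq_row_of_unitary {U : Matrix ι ι ℂ} (hU : U ∈ Matrix.unitaryGroup ι ℂ) (i : ι) :
    ∑ j, ‖U i j‖ ^ 2 = 1 := by
  have h := congrFun (congrFun (Matrix.mem_unitaryGroup_iff.1 hU) i) i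
  rw [Matrix.mul_apply, Matrix.one_apply_eq] at h
  have h2 : ((∑ j, ‖U i j‖ ^ 2 : ℝ) : ℂ) = 1 := by
    rw [← h]
    push_cast
    exact Finset.sum_congr rfl fun j _ => by
      rw [Matrix.star_apply, Complex.star_def, Complex.mul_conj']
  exact_mod_cast h2

theorem sum_norm_sq_col_of_unitary {U : Matrix ι ι ℂ} (hU : U ∈ Matrix.unitaryGroup ι ℂ) (j : ι) :
    ∑ i, ‖U i j‖ ^ 2 = 1 := by
  have h := sum_norm_sq_row_of_unitary (conjTranspose_mem_unitaryGroup hU) j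
  simpa using h

theorem sum_rpow_mul_rpow_le {σ : Type*} (s : Finset σ) {f g : σ → ℝ} (hf : ∀ i, 0 ≤ f i)
    (hg : ∀ i, 0 ≤ g i) {θ : ℝ} (h0 : 0 ≤ θ) (h1 : θ ≤ 1) :
    ∑ i ∈ s, f i ^ θ * g i ^ (1 - θ) ≤ (∑ i ∈ s, f i) ^ θ * (∑ i ∈ s, g i) ^ (1 - θ) := by
  rcases h0.eq_or_lt with rfl | h0
  · simp
  rcases h1.eq_or_lt with rfl | h1
  · simp
  have h1' : 0 < 1 - θ := sub_pos.2 h1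
  have hpq : (1 / θ).HolderConjugate (1 / (1 - θ)) :=
    Real.holderConjugate_iff.2 ⟨by rw [lt_div_iff₀ h0]; linarith, by simp⟩
  have h := Real.inner_le_Lp_mul_Lq_of_nonneg s hpq (f := fun i => f i ^ θ)
    (g := fun i => g i ^ (1 - θ)) (fun i _ => Real.rpow_nonneg (hf i) _)
    (fun i _ => Real.rpow_nonneg (hg i) _)
  simp_rw [← Real.rpow_mul (hf _), ← Real.rpow_mul (hg _)] at h
  simpa [h0.ne', h1'.ne'] using h

/-- Hölder's inequality for the trace of a product of powers of positive matrices. In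
eigenbases of the two matrices it is the scalar inequality with doubly stochastic weights. -/
theorem trace_psdPow_mul_psdPow_le {P Q : Matrix ι ι ℂ} (hP : P.PosSemidef)
    (hQ : Q.PosSemidef) (s t : ℝ) {θ : ℝ} (h0 : 0 ≤ θ) (h1 : θ ≤ 1) :
    (psdPow P (s * θ) * psdPow Q (t * (1 - θ))).trace.re
      ≤ (psdPow P s).trace.re ^ θ * (psdPow Q t).trace.re ^ (1 - θ) := by
  obtain ⟨U, hU, d, hd, rfl⟩ := exists_unitary_realDiag hP
  obtain ⟨V, hV, e, he, rfl⟩ := exists_unitary_realDiag hQ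
  have hE : Uᴴ * V ∈ Matrix.unitaryGroup ι ℂ := mul_mem (conjTranspose_mem_unitaryGroup hU) hV
  rw [trace_psdPow hU, trace_psdPow hV, psdPow_conj_realDiag hU, psdPow_conj_realDiag hV,
    trace_conj_mul_conj, Complex.ofReal_re, Complex.ofReal_re, Complex.ofReal_re]
  set E := Uᴴ * V
  have h := sum_rpow_mul_rpow_le (Finset.univ : Finset (ι × ι))
    (f := fun x => d x.1 ^ s * ‖E x.1 x.2‖ ^ 2) (g := fun x => e x.2 ^ t * ‖E x.1 x.2‖ ^ 2)
    (fun x => mul_nonneg (Real.rpow_nonneg (hd _) _) (by positivity))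
    (fun x => mul_nonneg (Real.rpow_nonneg (he _) _) (by positivity)) h0 h1
  have hf : ∑ x : ι × ι, d x.1 ^ s * ‖E x.1 x.2‖ ^ 2 = ∑ i, d i ^ s := by
    rw [Fintype.sum_prod_type]
    simp_rw [← Finset.mul_sum, sum_norm_sq_row_of_unitary hE, mul_one]
  have hg : ∑ x : ι × ι, e x.2 ^ t * ‖E x.1 x.2‖ ^ 2 = ∑ i, e i ^ t := by
    rw [Fintype.sum_prod_type_right]
    simp_rw [← Finset.mul_sum, sum_norm_sq_col_of_unitary hE, mul_one]
  rw [hf, hg, Fintype.sum_prod_type] at h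
  refine le_trans (le_of_eq ?_) h
  refine Finset.sum_congr rfl fun i _ => Finset.sum_congr rfl fun j _ => ?_
  have hw : (0 : ℝ) ≤ ‖E i j‖ ^ 2 := by positivity
  rw [Real.mul_rpow (Real.rpow_nonneg (hd i) _) hw, Real.mul_rpow (Real.rpow_nonneg (he j) _) hw,
    ← Real.rpow_mul (hd i), ← Real.rpow_mul (he j)]
  have : (‖E i j‖ ^ 2) ^ θ * (‖E i j‖ ^ 2) ^ (1 - θ) = ‖E i j‖ ^ 2 := by
    rw [← Real.rpow_add_of_nonneg hw h0 (sub_nonneg.2 h1), add_sub_cancel, Real.rpow_one]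
  calc _ = d i ^ (s * θ) * ((‖E i j‖ ^ 2) ^ θ * (‖E i j‖ ^ 2) ^ (1 - θ)) * e j ^ (t * (1 - θ)) := by
        rw [this]
    _ = _ := by ring

section Duality

open scoped Matrix.Norms.L2Operator

/-- The limiting case of Hölder's inequality in which one exponent is infinite. -/
theorem trace_psdPow_conjTranspose_mul_self_mul_le (A : Matrix ι ι ℂ) {Q : Matrix ι ι ℂ}
    (hQ : Q.PosSemidef) {p : ℝ} (hp : 0 ≤ p) :
    (psdPow (Aᴴ * A) p * Q).trace.re ≤ ‖A‖ ^ (2 * p) * Q.trace.re := by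
  obtain ⟨U, hU, V, hV, s, hs, rfl⟩ := exists_singularValueDecomposition A
  obtain ⟨W, hW, e, he, rfl⟩ := exists_unitary_realDiag hQ
  have hsA : ∀ i, s i ≤ ‖U * realDiag s * V‖ := by
    intro i
    have h1 : realDiag s = Uᴴ * (U * realDiag s * V) * Vᴴ := by
      have hUU : Uᴴ * U = 1 := Matrix.mem_unitaryGroup_iff'.1 hU
      have hVV : V * Vᴴ = 1 := Matrix.mem_unitaryGroup_iff.1 hV
      calc realDiag s = (Uᴴ * U) * realDiag s * (V * Vᴴ) := by rw [hUU, hVV]; simp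
        _ = _ := by simp only [mul_assoc]
    have h2 : ‖realDiag s‖ ≤ ‖U * realDiag s * V‖ := by
      conv_lhs => rw [h1]
      refine (norm_mul_le _ _).trans ((mul_le_of_le_one_right (norm_nonneg _)
        (norm_unitary_le_one (conjTranspose_mem_unitaryGroup hV))).trans ?_)
      exact (norm_mul_le _ _).trans (mul_le_of_le_one_left (norm_nonneg _)
        (norm_unitary_le_one (conjTranspose_mem_unitaryGroup hU)))
    have h3 := norm_entry_le (realDiag s) i i
    simp only [Matrix.diagonal_apply_eq, Complex.norm_real, Real.norm_eq_abs] at h3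
    exact (le_abs_self _).trans (h3.trans h2)
  have hps := psdPow_conjTranspose_mul_self_svd hU hV hs p
  rw [hps]
  have h4 := trace_conj_mul_conj Vᴴ W (fun i => s i ^ (2 * p)) e
  rw [Matrix.conjTranspose_conjTranspose] at h4
  rw [h4, Complex.ofReal_re, trace_conj_unitary hW, Matrix.trace_diagonal, ← Complex.ofReal_sum,
    Complex.ofReal_re, Finset.sum_comm, Finset.mul_sum]
  refine Finset.sum_le_sum fun j _ => ?_
  calc ∑ i, s i ^ (2 * p) * ‖(V * W) i j‖ ^ 2 * e j
      ≤ ∑ i, ‖U * realDiag s * V‖ ^ (2 * p) * ‖(V * W) i j‖ ^ 2 * e j := by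
        refine Finset.sum_le_sum fun i _ => ?_
        have := he j
        have := Real.rpow_le_rpow (hs i) (hsA i) (by positivity : 0 ≤ 2 * p)
        gcongr
    _ = _ := by
        rw [← Finset.sum_mul, ← Finset.mul_sum, sum_norm_sq_col_of_unitary (mul_mem hV hW), mul_one]

/-- The interpolation inequality for arbitrary matrices around a positive one. -/
theorem norm_trace_factor_mul_le {θ : ℝ} (h0 : 0 < θ) (h1 : θ ≤ 1)
    {w : κ → ℝ} (hw : ∀ i, 0 ≤ w i) {C₁ : Matrix ι κ ℂ} {C₂ : Matrix κ ι ℂ}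
    (hC₁ : ‖C₁‖ ≤ 1) (hC₂ : ‖C₂‖ ≤ 1) (A B : Matrix ι ι ℂ) {Y : Matrix ι ι ℂ}
    (hY : Y.PosSemidef) :
    ‖(C₁ * realDiag (fun i => w i ^ (1 - θ)) * C₂ * (A * Y * B)).trace‖
      ≤ (∑ i, w i) ^ (1 - θ) * (√(psdPow (Aᴴ * A) (1 / θ) * psdPow Y (1 / θ)).trace.re
        * √(psdPow Y (1 / θ) * psdPow (B * Bᴴ) (1 / θ)).trace.re) ^ θ := by
  obtain ⟨U₁, hU₁, V₁, hV₁, a, ha, rfl⟩ := exists_singularValueDecomposition A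
  obtain ⟨U₂, hU₂, V₂, hV₂, b, hb, rfl⟩ := exists_singularValueDecomposition B
  obtain ⟨U, hU, y, hy, rfl⟩ := exists_unitary_realDiag hY
  have hA := trace_conj_mul_conj V₁ᴴ U (fun i => a i ^ (2 * (1 / θ))) (fun i => y i ^ (1 / θ))
  have hB := trace_conj_mul_conj U U₂ (fun i => y i ^ (1 / θ)) (fun i => b i ^ (2 * (1 / θ)))
  rw [Matrix.conjTranspose_conjTranspose] at hA
  rw [psdPow_conjTranspose_mul_self_svd hU₁ hV₁ ha, psdPow_self_mul_conjTranspose_svd hU₂ hV₂ hb,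
    psdPow_conj_realDiag hU, hA, hB, Complex.ofReal_re, Complex.ofReal_re]
  have hr : ∀ {x : ℝ}, 0 ≤ x → (x ^ (1 / θ)) ^ θ = x := fun {x} hx => by
    rw [← Real.rpow_mul hx, one_div_mul_cancel h0.ne', Real.rpow_one]
  have hsq : ∀ {x : ℝ}, 0 ≤ x → (x ^ (1 / θ)) ^ 2 = x ^ (2 * (1 / θ)) := fun {x} hx => by
    rw [← Real.rpow_natCast, ← Real.rpow_mul hx, mul_comm]
    norm_num
  have h := norm_trace_interpolation h0 h1 hw
    (a := fun i => a i ^ (1 / θ)) (fun i => Real.rpow_nonneg (ha i) _)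
    (y := fun i => y i ^ (1 / θ)) (fun i => Real.rpow_nonneg (hy i) _)
    (b := fun i => b i ^ (1 / θ)) (fun i => Real.rpow_nonneg (hb i) _)
    (norm_mul_le_one hC₂ (norm_unitary_le_one hU₁))
    (norm_mul_le_one (norm_unitary_le_one hV₁) (norm_unitary_le_one hU))
    (norm_mul_le_one (norm_unitary_le_one (conjTranspose_mem_unitaryGroup hU))
      (norm_unitary_le_one hU₂))
    (norm_mul_le_one (norm_unitary_le_one hV₂) hC₁)
  simp only [hr (ha _), hr (hy _), hr (hb _), hsq (ha _), hsq (hb _)] at h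
  refine le_trans (le_of_eq ?_) h
  congr 1
  rw [Matrix.mul_assoc C₁, Matrix.mul_assoc C₁, Matrix.trace_mul_comm]
  simp only [Matrix.mul_assoc]

/-- Elements `C₁ w ^ (1 - 1/p) C₂` with contractions `C₁, C₂` and `∑ w ≤ 1` lie in the dual unit
ball. The contractions may be rectangular, which makes compressions decrease the norm. -/
theorem norm_trace_factor_le {p : ℝ} (hp : 1 ≤ p)
    {w : κ → ℝ} (hw : ∀ i, 0 ≤ w i) (hw1 : ∑ i, w i ≤ 1) {C₁ : Matrix ι κ ℂ} {C₂ : Matrix κ ι ℂ}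
    (hC₁ : ‖C₁‖ ≤ 1) (hC₂ : ‖C₂‖ ≤ 1) (X : Matrix ι ι ℂ) :
    ‖(C₁ * realDiag (fun i => w i ^ (1 - 1 / p)) * C₂ * X).trace‖
      ≤ schattenNorm (ENNReal.ofReal p) X := by
  have hp0 : 0 < p := by linarith
  have hθ : 1 / p ≤ 1 := by rw [div_le_one hp0]; exact hp
  obtain ⟨U, hU, V, hV, s, hs, rfl⟩ := exists_singularValueDecomposition X
  rw [schattenNorm_svd hp0.le hU hV hs]
  have hr : ∀ {x : ℝ}, 0 ≤ x → (x ^ p) ^ (1 / p) = x := fun {x} hx => by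
    rw [← Real.rpow_mul hx, mul_one_div_cancel hp0.ne', Real.rpow_one]
  have hone : ‖(1 : Matrix ι ι ℂ)‖ ≤ 1 := norm_unitary_le_one (one_mem _)
  have h := norm_trace_interpolation (θ := 1 / p) (by positivity) hθ hw
    (a := fun _ : ι => 1) (fun i => zero_le_one)
    (y := fun i => s i ^ p) (fun i => Real.rpow_nonneg (hs i) _)
    (b := fun _ : ι => 1) (fun i => zero_le_one)
    (norm_mul_le_one hC₂ (norm_unitary_le_one hU)) hone hone
    (norm_mul_le_one (norm_unitary_le_one hV) hC₁)
  have hN : 0 ≤ ∑ i, s i ^ p := Finset.sum_nonneg fun i _ => Real.rpow_nonneg (hs i) _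
  have hd : (Matrix.diagonal fun _ : ι => (1 : ℂ)) = 1 := Matrix.diagonal_one
  have h1 : ∑ i : ι, ∑ j, (1 : ℝ) ^ 2 * ‖(1 : Matrix ι ι ℂ) i j‖ ^ 2 * s j ^ p = ∑ i, s i ^ p := by
    refine Finset.sum_congr rfl fun i _ => ?_
    rw [Finset.sum_eq_single i] <;> simp +contextual [eq_comm]
  have h2 : ∑ i : ι, ∑ j, s i ^ p * ‖(1 : Matrix ι ι ℂ) i j‖ ^ 2 * (1 : ℝ) ^ 2 = ∑ i, s i ^ p := by
    refine Finset.sum_congr rfl fun i _ => ?_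
    rw [Finset.sum_eq_single i] <;> simp +contextual [eq_comm]
  rw [h1, h2, Real.mul_self_sqrt hN] at h
  simp only [hr (hs _), Real.one_rpow, realDiag, Complex.ofReal_one, hd, Matrix.mul_one] at h
  have hc : (C₁ * realDiag (fun i => w i ^ (1 - 1 / p)) * C₂ * (U * realDiag s * V)).trace
      = (realDiag (fun i => w i ^ (1 - 1 / p)) * (C₂ * U * realDiag s * (V * C₁))).trace := by
    rw [Matrix.mul_assoc C₁, Matrix.mul_assoc C₁, Matrix.trace_mul_comm]
    simp only [Matrix.mul_assoc]
  rw [hc]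
  exact h.trans (mul_le_of_le_one_left (by positivity) (Real.rpow_le_one
    (Finset.sum_nonneg fun i _ => hw i) hw1 (by linarith)))

/-- Duality: the Schatten norm is attained as a pairing with an element of the dual unit ball. -/
theorem exists_trace_factor_eq {p : ℝ} (hp : 1 ≤ p) (X : Matrix ι ι ℂ) :
    ∃ (C₁ C₂ : Matrix ι ι ℂ) (w : ι → ℝ), ‖C₁‖ ≤ 1 ∧ ‖C₂‖ ≤ 1 ∧ (∀ i, 0 ≤ w i) ∧ ∑ i, w i ≤ 1 ∧
      (C₁ * realDiag (fun i => w i ^ (1 - 1 / p)) * C₂ * X).trace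
        = (schattenNorm (ENNReal.ofReal p) X : ℂ) := by
  have hp0 : 0 < p := by linarith
  obtain ⟨U, hU, V, hV, s, hs, rfl⟩ := exists_singularValueDecomposition X
  have hUU : Uᴴ * U = 1 := Matrix.mem_unitaryGroup_iff'.1 hU
  rw [schattenNorm_svd hp0.le hU hV hs]
  set N := ∑ i, s i ^ p with hNdef
  have hN : 0 ≤ N := Finset.sum_nonneg fun i _ => Real.rpow_nonneg (hs i) _
  refine ⟨Vᴴ, Uᴴ, fun i => s i ^ p / N, norm_unitary_le_one (conjTranspose_mem_unitaryGroup hV),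
    norm_unitary_le_one (conjTranspose_mem_unitaryGroup hU),
    fun i => div_nonneg (Real.rpow_nonneg (hs i) _) hN, ?_, ?_⟩
  · rw [← Finset.sum_div]
    exact div_self_le_one N
  have htr : ∀ D : Matrix ι ι ℂ, (Vᴴ * D * Uᴴ * (U * realDiag s * V)).trace
      = (D * realDiag s).trace := by
    intro D
    calc _ = (Vᴴ * (D * (Uᴴ * U) * realDiag s) * Vᴴᴴ).trace := by
          rw [Matrix.conjTranspose_conjTranspose]; simp only [mul_assoc]
      _ = _ := by rw [trace_conj_unitary (conjTranspose_mem_unitaryGroup hV), hUU, mul_one]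
  rw [htr, realDiag_mul, Matrix.trace_diagonal, ← Complex.ofReal_sum]
  congr 1
  rcases hN.eq_or_lt with h | h
  · have h0 : ∀ i, s i = 0 := fun i => by
      have := (Finset.sum_eq_zero_iff_of_nonneg
        (fun i _ => Real.rpow_nonneg (hs i) p)).1 h.symm i (Finset.mem_univ i)
      exact ((Real.rpow_eq_zero_iff_of_nonneg (hs i)).1 this).1
    simp [h0, ← h, Real.zero_rpow (inv_pos.2 hp0).ne']
  · have hterm : ∀ i, (s i ^ p / N) ^ (1 - 1 / p) * s i = s i ^ p / N ^ (1 - 1 / p) := by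
      intro i
      rw [Real.div_rpow (Real.rpow_nonneg (hs i) _) hN, ← Real.rpow_mul (hs i), div_mul_eq_mul_div]
      congr 1
      have he : p * (1 - 1 / p) = p - 1 := by field_simp
      rw [he]
      conv_lhs => rw [← Real.rpow_one (s i), ← Real.rpow_mul (hs i), one_mul]
      rw [← Real.rpow_add_of_nonneg (hs i) (by linarith) zero_le_one, sub_add_cancel]
    simp_rw [hterm, ← Finset.sum_div, ← hNdef]
    rw [div_eq_iff (by positivity), ← Real.rpow_add h, add_sub_cancel, Real.rpow_one]

theorem schattenNorm_ofReal_nonneg {p : ℝ} (hp : 0 ≤ p) (X : Matrix ι ι ℂ) :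
    0 ≤ schattenNorm (ENNReal.ofReal p) X := by
  obtain ⟨U, hU, V, hV, s, hs, rfl⟩ := exists_singularValueDecomposition X
  rw [schattenNorm_svd hp hU hV hs]
  exact Real.rpow_nonneg (Finset.sum_nonneg fun i _ => Real.rpow_nonneg (hs i) _) _

theorem schattenNorm_sub_le {p : ℝ} (hp : 1 ≤ p) (X Y : Matrix ι ι ℂ) :
    schattenNorm (ENNReal.ofReal p) (X - Y)
      ≤ schattenNorm (ENNReal.ofReal p) X + schattenNorm (ENNReal.ofReal p) Y := by
  obtain ⟨C₁, C₂, w, h₁, h₂, hw, hw1, h⟩ := exists_trace_factor_eq hp (X - Y)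
  have hn := congrArg norm h
  rw [Complex.norm_real, Real.norm_of_nonneg (schattenNorm_ofReal_nonneg (by linarith) _)] at hn
  rw [← hn, Matrix.mul_sub, Matrix.trace_sub]
  exact (norm_sub_le _ _).trans (add_le_add (norm_trace_factor_le hp hw hw1 h₁ h₂ X)
    (norm_trace_factor_le hp hw hw1 h₁ h₂ Y))

theorem schattenNorm_compression_le {p : ℝ} (hp : 1 ≤ p) {J₁ : Matrix ι κ ℂ} {J₂ : Matrix κ ι ℂ}
    (hJ₁ : ‖J₁‖ ≤ 1) (hJ₂ : ‖J₂‖ ≤ 1) (X : Matrix κ κ ℂ) :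
    schattenNorm (ENNReal.ofReal p) (J₁ * X * J₂) ≤ schattenNorm (ENNReal.ofReal p) X := by
  obtain ⟨C₁, C₂, w, h₁, h₂, hw, hw1, h⟩ := exists_trace_factor_eq hp (J₁ * X * J₂)
  have hn := congrArg norm h
  rw [Complex.norm_real, Real.norm_of_nonneg (schattenNorm_ofReal_nonneg (by linarith) _)] at hn
  rw [← hn]
  have hc : ∀ D : Matrix ι ι ℂ, (C₁ * D * C₂ * (J₁ * X * J₂)).trace
      = ((J₂ * C₁) * D * (C₂ * J₁) * X).trace := by
    intro D
    rw [← Matrix.mul_assoc, Matrix.trace_mul_comm]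
    simp only [Matrix.mul_assoc]
  rw [hc]
  exact norm_trace_factor_le hp hw hw1 (norm_mul_le_one hJ₂ h₁) (norm_mul_le_one h₂ hJ₁) X

/-- Hölder's inequality with exponents `2p`, `2p` for the product `(A Y^{1/2}) (Y^{1/2} B)`, with
each factor bounded by the Araki–Lieb–Thirring inequality. -/
theorem schattenNorm_mul_mul_le {p : ℝ} (hp : 1 ≤ p) (A B : Matrix ι ι ℂ) {Y : Matrix ι ι ℂ}
    (hY : Y.PosSemidef) :
    schattenNorm (ENNReal.ofReal p) (A * Y * B)
      ≤ (√(psdPow (Aᴴ * A) p * psdPow Y p).trace.re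
        * √(psdPow Y p * psdPow (B * Bᴴ) p).trace.re) ^ (1 / p) := by
  have hp0 : 0 < p := by linarith
  have hθ : 1 / p ≤ 1 := by rw [div_le_one hp0]; exact hp
  obtain ⟨C₁, C₂, w, h₁, h₂, hw, hw1, h⟩ := exists_trace_factor_eq hp (A * Y * B)
  have hn := congrArg norm h
  rw [Complex.norm_real, Real.norm_of_nonneg (schattenNorm_ofReal_nonneg hp0.le _)] at hn
  rw [← hn]
  have := norm_trace_factor_mul_le (θ := 1 / p) (by positivity) hθ hw h₁ h₂ A B hY
  rw [one_div_one_div] at this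
  exact this.trans (mul_le_of_le_one_left (by positivity) (Real.rpow_le_one
    (Finset.sum_nonneg fun i _ => hw i) hw1 (by linarith)))

/-- The pairing of `Z` with `A Y B`, estimated in the conjugate exponent. -/
theorem norm_trace_mul_mul_mul_le {p s : ℝ} (hps : p.HolderConjugate s) (Z A B : Matrix ι ι ℂ)
    {Y : Matrix ι ι ℂ} (hY : Y.PosSemidef) :
    ‖(Z * (A * Y * B)).trace‖ ≤ schattenNorm (ENNReal.ofReal p) Z *
      (√(psdPow (Aᴴ * A) s * psdPow Y s).trace.re
        * √(psdPow Y s * psdPow (B * Bᴴ) s).trace.re) ^ (1 / s) := by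
  have hp0 := hps.pos
  have hs0 := hps.symm.pos
  have hθ : 1 - 1 / s = 1 / p := by
    have := hps.inv_add_inv_eq_one
    rw [one_div, one_div]
    linarith
  obtain ⟨U, hU, V, hV, z, hz, rfl⟩ := exists_singularValueDecomposition Z
  have := norm_trace_factor_mul_le (θ := 1 / s) (by positivity)
    (by have : 0 < 1 / p := by positivity
        linarith)
    (w := fun i => z i ^ p) (fun i => Real.rpow_nonneg (hz i) _) (norm_unitary_le_one hU)
    (norm_unitary_le_one hV) A B hY
  rw [one_div_one_div, hθ] at this
  simp_rw [← Real.rpow_mul (hz _), mul_one_div_cancel hp0.ne', Real.rpow_one] at this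
  rwa [schattenNorm_svd hp0.le hU hV hz]

end Duality

/-! ### The Pisier-type norm of a positive matrix is at most `Ψ` -/

theorem trace_kronecker_one_mul (X : Matrix ι ι ℂ) (Z : Matrix (ι × κ) (ι × κ) ℂ) :
    ((X ⊗ₖ (1 : Matrix κ κ ℂ)) * Z).trace = (X * partialTrace₂ Z).trace := by
  simp only [Matrix.trace, Matrix.diag_apply, Matrix.mul_apply, partialTrace₂, Matrix.of_apply,
    Fintype.sum_prod_type, Matrix.kroneckerMap_apply, Matrix.one_apply, Finset.mul_sum]
  refine Finset.sum_congr rfl fun i _ => ?_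
  rw [Finset.sum_comm]
  refine Finset.sum_congr rfl fun j _ => ?_
  rw [Finset.sum_comm]
  refine Finset.sum_congr rfl fun k _ => ?_
  rw [Finset.sum_eq_single k] <;> simp +contextual

theorem partialTrace₂_kronecker (X : Matrix ι ι ℂ) (Z : Matrix κ κ ℂ) :
    partialTrace₂ (X ⊗ₖ Z) = Z.trace • X := by
  ext i j
  simp [partialTrace₂, Matrix.trace, ← Finset.mul_sum, mul_comm]

theorem partialTrace₂_posSemidef {Y : Matrix (ι × κ) (ι × κ) ℂ} (hY : Y.PosSemidef) :
    (partialTrace₂ Y).PosSemidef := by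
  have : partialTrace₂ Y = ∑ k : κ, Y.submatrix (fun i => (i, k)) (fun i => (i, k)) := by
    ext i j
    simp [partialTrace₂, Matrix.sum_apply]
  rw [this]
  exact Matrix.posSemidef_sum _ fun k _ => hY.submatrix _

theorem psdPow_ofReal_smul {Y : Matrix ι ι ℂ} (hY : Y.PosSemidef) {c : ℝ} (hc : 0 ≤ c) (s : ℝ) :
    psdPow ((c : ℂ) • Y) s = ((c ^ s : ℝ) : ℂ) • psdPow Y s := by
  obtain ⟨U, hU, d, hd, rfl⟩ := exists_unitary_realDiag hY
  have h : ∀ (c : ℝ) (d : ι → ℝ), (c : ℂ) • (U * realDiag d * Uᴴ)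
      = U * realDiag (fun i => c * d i) * Uᴴ := by
    intro c d
    rw [← Matrix.smul_mul, ← Matrix.mul_smul, ← Matrix.diagonal_smul]
    congr 3
    ext i
    simp
  rw [h, psdPow_conj_realDiag hU, psdPow_conj_realDiag hU, h]
  simp_rw [Real.mul_rpow hc (hd _)]

theorem psi_nonneg (p q : ℝ) {Y : Matrix (ι × κ) (ι × κ) ℂ} (hY : Y.PosSemidef) :
    0 ≤ psi p q Y :=
  Real.rpow_nonneg (trace_re_nonneg (psdPow_posSemidef
    (partialTrace₂_posSemidef (psdPow_posSemidef hY _)) _)) _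

theorem psi_kronecker {p q : ℝ} (hp : 0 < p) (hq : 0 < q) {Y : Matrix ι ι ℂ} {Z : Matrix κ κ ℂ}
    (hY : Y.PosSemidef) (hZ : Z.PosSemidef) :
    psi p q (Y ⊗ₖ Z) = (psdPow Y q).trace.re ^ (1 / q) * (psdPow Z p).trace.re ^ (1 / p) := by
  have hR := trace_re_nonneg (psdPow_posSemidef hZ p)
  have hS := trace_re_nonneg (psdPow_posSemidef hY q)
  have h1 : p * (q / p) = q := by field_simp
  rw [psi, psdPow_kronecker hY hZ, partialTrace₂_kronecker, trace_eq_re (psdPow_posSemidef hZ p),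
    psdPow_ofReal_smul (psdPow_posSemidef hY p) hR, psdPow_psdPow hY, h1, Matrix.trace_smul,
    smul_eq_mul, Complex.re_ofReal_mul, Real.mul_rpow (Real.rpow_nonneg hR _) hS,
    ← Real.rpow_mul hR, mul_comm]
  congr 2
  field_simp

/-- The finite exponent `r` for `p ≠ q`. -/
theorem two_mul_rExp {p q : ℝ} (h : 0 < max (1 / p) (1 / q) - min (1 / p) (1 / q)) :
    2 * rExp p q = ENNReal.ofReal (2 * (max (1 / p) (1 / q) - min (1 / p) (1 / q))⁻¹) := by
  rw [rExp, ← ENNReal.ofReal_inv_of_pos h, ENNReal.ofReal_mul zero_le_two]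
  simp

theorem two_mul_rExp_self (p : ℝ) : 2 * rExp p p = ∞ := by simp [rExp, ENNReal.mul_top]

open scoped Matrix.Norms.L2Operator in
theorem schattenNorm_top (A : Matrix ι ι ℂ) : schattenNorm ∞ A = ‖A‖ := by
  rw [schattenNorm, if_pos rfl]
  rfl

open scoped Matrix.Norms.L2Operator in
theorem schattenNorm_conjTranspose (s : ℝ≥0∞) (A : Matrix ι ι ℂ) :
    schattenNorm s Aᴴ = schattenNorm s A := by
  by_cases h : s = ∞
  · rw [h, schattenNorm_top, schattenNorm_top, Matrix.l2_opNorm_conjTranspose]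
  · rw [schattenNorm, schattenNorm, if_neg h, if_neg h, modulus_psdPow, modulus_psdPow,
      Matrix.conjTranspose_conjTranspose, trace_psdPow_self_mul_conjTranspose]

theorem schattenNorm_neg (s : ℝ≥0∞) (A : Matrix ι ι ℂ) :
    schattenNorm s (-A) = schattenNorm s A := by
  simp [schattenNorm, modulus]

open scoped Matrix.Norms.L2Operator in
theorem schattenNorm_nonneg (s : ℝ≥0∞) (A : Matrix ι ι ℂ) : 0 ≤ schattenNorm s A := by
  by_cases h : s = ∞
  · rw [h, schattenNorm_top]
    exact norm_nonneg A
  · rw [← ENNReal.ofReal_toReal h]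
    exact schattenNorm_ofReal_nonneg ENNReal.toReal_nonneg A

theorem schattenNorm_two_mul_rpow {ρ : ℝ} (hρ : 0 < ρ) (A : Matrix ι ι ℂ) (s : ℝ) :
    schattenNorm (ENNReal.ofReal (2 * ρ)) A ^ (2 * s) = (psdPow (Aᴴ * A) ρ).trace.re ^ (s / ρ) := by
  rw [schattenNorm_ofReal (by positivity), ← Real.rpow_mul (trace_re_nonneg (psdPow_posSemidef
    (Matrix.posSemidef_conjTranspose_mul_self A) _)), mul_div_cancel_left₀ _ two_ne_zero]
  congr 1
  field_simp

/-- Hölder's inequality on the outside space with exponents `r/p` and `q/p`, including the case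
`p = q`, `r = ∞`. -/
theorem trace_psdPow_mul_le_of_le {p q : ℝ} (hp : 0 < p) (hpq : p ≤ q) (A : Matrix ι ι ℂ)
    {T : Matrix ι ι ℂ} (hT : T.PosSemidef) :
    (psdPow (Aᴴ * A) p * T).trace.re
      ≤ schattenNorm (2 * rExp p q) A ^ (2 * p) * (psdPow T (q / p)).trace.re ^ (p / q) := by
  have hq : 0 < q := hp.trans_le hpq
  rcases hpq.eq_or_lt with rfl | hlt
  · rw [two_mul_rExp_self, schattenNorm_top, div_self hp.ne', psdPow_one hT, Real.rpow_one]
    exact trace_psdPow_conjTranspose_mul_self_mul_le A hT hp.le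
  · have hlt' : 1 / q < 1 / p := one_div_lt_one_div_of_lt hp hlt
    have hpos : 0 < 1 / p - 1 / q := sub_pos.2 hlt'
    have hd : max (1 / p) (1 / q) - min (1 / p) (1 / q) = 1 / p - 1 / q := by
      rw [max_eq_left hlt'.le, min_eq_right hlt'.le]
    rw [two_mul_rExp (by rwa [hd]), hd, schattenNorm_two_mul_rpow (inv_pos.2 hpos)]
    set ρ := (1 / p - 1 / q)⁻¹ with hρ
    have hρ0 : 0 < ρ := inv_pos.2 hpos
    have hθ : p / ρ = 1 - p / q := by
      rw [hρ, div_inv_eq_mul]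
      field_simp
    have h := trace_psdPow_mul_psdPow_le (Matrix.posSemidef_conjTranspose_mul_self A) hT ρ (q / p)
      (θ := p / ρ) (by positivity) (by rw [hθ]; have : 0 < p / q := by positivity
                                       linarith)
    have h1 : 1 - p / ρ = p / q := by rw [hθ]; ring
    have h2 : q / p * (p / q) = 1 := by field_simp
    rwa [h1, h2, mul_div_cancel₀ _ hρ0.ne', psdPow_one hT] at h

theorem sqrt_mul_sqrt_rpow {a b t s : ℝ} (ha : 0 ≤ a) (hb : 0 ≤ b) (ht : 0 ≤ t) (hs : 0 < s) :
    (√(a ^ (2 * s) * t) * √(b ^ (2 * s) * t)) ^ (1 / s) = a * b * t ^ (1 / s) := by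
  have h : ∀ {x : ℝ}, 0 ≤ x → √(x ^ (2 * s) * t) = x ^ s * √t := by
    intro x hx
    have h1 : x ^ (2 * s) = (x ^ s) ^ 2 := by
      rw [← Real.rpow_natCast, ← Real.rpow_mul hx, mul_comm]
      norm_num
    rw [Real.sqrt_mul (by positivity), h1, Real.sqrt_sq (by positivity)]
  have h2 : a ^ s * √t * (b ^ s * √t) = (a * b) ^ s * t := by
    rw [Real.mul_rpow ha hb]
    calc _ = a ^ s * b ^ s * (√t * √t) := by ring
      _ = _ := by rw [Real.mul_self_sqrt ht]
  rw [h ha, h hb, h2, Real.mul_rpow (by positivity) ht, ← Real.rpow_mul (by positivity),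
    mul_one_div_cancel hs.ne', Real.rpow_one]

theorem psdPow_kronecker_one (A : Matrix ι ι ℂ) (s : ℝ) :
    psdPow ((A ⊗ₖ (1 : Matrix κ κ ℂ))ᴴ * (A ⊗ₖ (1 : Matrix κ κ ℂ))) s
      = psdPow (Aᴴ * A) s ⊗ₖ (1 : Matrix κ κ ℂ) := by
  rw [Matrix.conjTranspose_kronecker, Matrix.conjTranspose_one, ← Matrix.mul_kronecker_mul,
    Matrix.mul_one, psdPow_kronecker (Matrix.posSemidef_conjTranspose_mul_self A)
      Matrix.PosSemidef.one, psdPow_one_matrix]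

theorem psdPow_kronecker_one_mul_conjTranspose (A : Matrix ι ι ℂ) (s : ℝ) :
    psdPow ((A ⊗ₖ (1 : Matrix κ κ ℂ)) * (A ⊗ₖ (1 : Matrix κ κ ℂ))ᴴ) s
      = psdPow (Aᴴᴴ * Aᴴ) s ⊗ₖ (1 : Matrix κ κ ℂ) := by
  rw [← psdPow_kronecker_one, Matrix.conjTranspose_kronecker, Matrix.conjTranspose_kronecker,
    Matrix.conjTranspose_conjTranspose, Matrix.conjTranspose_one]

theorem ncSup_le_psi {p q : ℝ} (hp : 1 ≤ p) (hpq : p ≤ q) {Y : Matrix (ι × κ) (ι × κ) ℂ}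
    (hY : Y.PosSemidef) : ncSup p q Y ≤ ENNReal.ofReal (psi p q Y) := by
  have hp0 : 0 < p := by linarith
  have hq0 : 0 < q := by linarith
  have hT := partialTrace₂_posSemidef (psdPow_posSemidef hY p)
  refine iSup₂_le fun A B => ENNReal.ofReal_le_ofReal ?_
  have hA := schattenNorm_nonneg (2 * rExp p q) A
  have hB := schattenNorm_nonneg (2 * rExp p q) B
  have ht := trace_re_nonneg (psdPow_posSemidef hT (q / p))
  refine div_le_of_le_mul₀ (mul_nonneg hA hB) (psi_nonneg p q hY) ?_
  refine (schattenNorm_mul_mul_le hp _ _ hY).trans ?_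
  rw [psdPow_kronecker_one, psdPow_kronecker_one_mul_conjTranspose,
    Matrix.trace_mul_comm (psdPow Y p), trace_kronecker_one_mul, trace_kronecker_one_mul]
  have h1 := trace_psdPow_mul_le_of_le hp0 hpq A hT
  have h2 := trace_psdPow_mul_le_of_le hp0 hpq Bᴴ hT
  rw [schattenNorm_conjTranspose] at h2
  have h3 : psi p q Y
      = ((psdPow (partialTrace₂ (psdPow Y p)) (q / p)).trace.re ^ (p / q)) ^ (1 / p) := by
    rw [psi, ← Real.rpow_mul ht]
    congr 1
    field_simp
  rw [h3, mul_comm (_ ^ (1 / p)), ← sqrt_mul_sqrt_rpow hA hB (Real.rpow_nonneg ht _) hp0]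
  gcongr

theorem ncInf_le_psi {p q : ℝ} (hq : 1 ≤ q) (hpq : q < p) {Y : Matrix (ι × κ) (ι × κ) ℂ}
    (hY : Y.PosSemidef) : ncInf p q Y ≤ ENNReal.ofReal (psi p q Y) := by
  have hq0 : 0 < q := by linarith
  have hp0 : 0 < p := by linarith
  have hT := partialTrace₂_posSemidef (psdPow_posSemidef hY p)
  obtain ⟨U, hU, t, ht, hTU⟩ := exists_unitary_realDiag hT
  have hUU : U * Uᴴ = 1 := Matrix.mem_unitaryGroup_iff.1 hU
  have hpsi : psi p q Y = (∑ i, t i ^ (q / p)) ^ (1 / q) := by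
    rw [psi, hTU, trace_psdPow hU, Complex.ofReal_re]
  have hlt' : 1 / p < 1 / q := one_div_lt_one_div_of_lt hq0 hpq
  have hpos : 0 < 1 / q - 1 / p := sub_pos.2 hlt'
  have hd : max (1 / p) (1 / q) - min (1 / p) (1 / q) = 1 / q - 1 / p := by
    rw [max_eq_right hlt'.le, min_eq_left hlt'.le]
  have hr := two_mul_rExp (p := p) (q := q) (by rwa [hd])
  rw [hd] at hr
  set ρ := (1 / q - 1 / p)⁻¹ with hρ
  have hρ0 : 0 < ρ := inv_pos.2 hpos
  -- the weight is a power of `T + ε`, which is invertible, and `ε` tends to `0`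
  have key : ∀ ε : ℝ, 0 < ε →
      ncInf p q Y ≤ ENNReal.ofReal ((∑ i, (t i + ε) ^ (q / p)) ^ (1 / q)) := by
    intro ε hε
    have hu : ∀ i, 0 < t i + ε := fun i => by linarith [ht i]
    set β : ℝ := q / p / ρ with hβ
    let D : ℝ → Matrix ι ι ℂ := fun s => U * realDiag (fun i => (t i + ε) ^ s) * Uᴴ
    have hDpos : ∀ s, (D s).PosSemidef := fun s =>
      posSemidef_conj_realDiag U fun i => Real.rpow_nonneg (hu i).le s
    have hDmul : ∀ s t, D s * D t = D (s + t) := fun s t => by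
      simp only [D, conj_realDiag_mul hU, ← Real.rpow_add (hu _)]
    have hDpow : ∀ s t, psdPow (D s) t = D (s * t) := fun s t => by
      simp only [D, psdPow_conj_realDiag hU, ← Real.rpow_mul (hu _).le]
    have hD0 : D 0 = 1 := by simp [D, realDiag, hUU]
    have hDtr : ∀ s, (D s).trace.re = ∑ i, (t i + ε) ^ s := fun s => by
      simp only [D, trace_conj_unitary hU, Matrix.trace_diagonal, ← Complex.ofReal_sum,
        Complex.ofReal_re]
    set S := ∑ i, (t i + ε) ^ (q / p)
    have hS0 : 0 ≤ S := Finset.sum_nonneg fun i _ => Real.rpow_nonneg (hu i).le _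
    let Z := (D (-(β / 2)) ⊗ₖ (1 : Matrix κ κ ℂ)) * Y * (D (-(β / 2)) ⊗ₖ (1 : Matrix κ κ ℂ))
    have hdec : Y = ∑ _i : Fin 1, (D (β / 2) ⊗ₖ (1 : Matrix κ κ ℂ)) * Z
        * (D (β / 2) ⊗ₖ (1 : Matrix κ κ ℂ)) := by
      have h1 : (D (β / 2) ⊗ₖ (1 : Matrix κ κ ℂ)) * (D (-(β / 2)) ⊗ₖ (1 : Matrix κ κ ℂ)) = 1 := by
        rw [← Matrix.mul_kronecker_mul, hDmul, add_neg_cancel, hD0, mul_one,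
          Matrix.one_kronecker_one]
      have h2 : (D (-(β / 2)) ⊗ₖ (1 : Matrix κ κ ℂ)) * (D (β / 2) ⊗ₖ (1 : Matrix κ κ ℂ)) = 1 := by
        rw [← Matrix.mul_kronecker_mul, hDmul, neg_add_cancel, hD0, mul_one,
          Matrix.one_kronecker_one]
      rw [Fin.sum_univ_one]
      calc Y = (D (β / 2) ⊗ₖ (1 : Matrix κ κ ℂ)) * (D (-(β / 2)) ⊗ₖ (1 : Matrix κ κ ℂ)) * Y
            * ((D (-(β / 2)) ⊗ₖ (1 : Matrix κ κ ℂ)) * (D (β / 2) ⊗ₖ (1 : Matrix κ κ ℂ))) := by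
            rw [h1, h2, one_mul, mul_one]
        _ = _ := by simp only [Z, mul_assoc]
    have hA : schattenNorm (2 * rExp p q) (D (β / 2)) = S ^ (1 / (2 * ρ)) := by
      rw [hr, schattenNorm_of_posSemidef (by positivity) (hDpos _), hDpow, hDtr]
      have : β / 2 * (2 * ρ) = q / p := by rw [hβ]; field_simp
      rw [this]
    have hZ : schattenNorm (ENNReal.ofReal p) Z ≤ S ^ (1 / p) := by
      refine (schattenNorm_mul_mul_le (hq.trans hpq.le) _ _ hY).trans ?_
      have hDH : (D (-(β / 2)))ᴴ = D (-(β / 2)) := (hDpos _).1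
      have hβp : β * p = 1 - q / p := by
        rw [hβ, hρ, div_inv_eq_mul]
        field_simp
      have hsum : (psdPow (D (-(β / 2)) * D (-(β / 2))) p * partialTrace₂ (psdPow Y p)).trace.re
          ≤ S := by
        rw [hDmul, hDpow, hTU]
        simp only [D]
        rw [conj_realDiag_mul hU, trace_conj_unitary hU, Matrix.trace_diagonal,
          ← Complex.ofReal_sum, Complex.ofReal_re]
        refine Finset.sum_le_sum fun i _ => ?_
        have he : (-(β / 2) + -(β / 2)) * p + 1 = q / p := by linarith
        rw [← he, Real.rpow_add (hu i), Real.rpow_one]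
        have := Real.rpow_nonneg (hu i).le ((-(β / 2) + -(β / 2)) * p)
        gcongr
        linarith
      rw [psdPow_kronecker_one, psdPow_kronecker_one_mul_conjTranspose,
        Matrix.trace_mul_comm (psdPow Y p), trace_kronecker_one_mul, trace_kronecker_one_mul,
        hDH, hDH]
      refine Real.rpow_le_rpow (by positivity) ?_ (by positivity)
      calc _ ≤ √S * √S := by gcongr
        _ = S := Real.mul_self_sqrt hS0
    refine iInf_le_of_le 1 (iInf_le_of_le (fun _ => D (β / 2)) (iInf_le_of_le (fun _ => D (β / 2))
      (iInf_le_of_le (fun _ => Z) (iInf_le_of_le hdec (ENNReal.ofReal_le_ofReal ?_)))))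
    rw [Fin.sum_univ_one, hA]
    have h3 : S ^ (1 / q) = S ^ (1 / (2 * ρ)) * S ^ (1 / (2 * ρ)) * S ^ (1 / p) := by
      rw [← Real.rpow_add_of_nonneg hS0 (by positivity) (by positivity),
        ← Real.rpow_add_of_nonneg hS0 (by positivity) (by positivity)]
      congr 1
      have : 1 / (2 * ρ) + 1 / (2 * ρ) = ρ⁻¹ := by field_simp; norm_num
      rw [this, hρ, inv_inv]
      ring
    rw [h3]
    gcongr
  rw [hpsi]
  have hcont : Continuous fun ε : ℝ =>
      ENNReal.ofReal ((∑ i, (t i + ε) ^ (q / p)) ^ (1 / q)) := by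
    refine ENNReal.continuous_ofReal.comp (Continuous.rpow_const ?_ fun _ => Or.inr (by positivity))
    exact continuous_finsetSum _ fun i _ =>
      (continuous_const.add continuous_id).rpow_const fun _ => Or.inr (by positivity)
  have hlim := (hcont.tendsto 0).mono_left (nhdsWithin_le_nhds (s := Set.Ioi 0))
  simp only [add_zero] at hlim
  exact ge_of_tendsto hlim (eventually_nhdsWithin_of_forall fun ε hε => key ε hε)

theorem ncNorm_le_psi {p q : ℝ} (hp : 1 ≤ p) (hq : 1 ≤ q) {Y : Matrix (ι × κ) (ι × κ) ℂ}
    (hY : Y.PosSemidef) : ncNorm p q Y ≤ ENNReal.ofReal (psi p q Y) := by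
  unfold ncNorm
  split_ifs with h
  · exact ncSup_le_psi hp h hY
  · exact ncInf_le_psi hq (not_le.1 h) hY

/-! ### Equality for positive elementary tensors -/

theorem psi_kronecker_le_ncSup {p q : ℝ} (hp : 1 ≤ p) (hpq : p ≤ q) {Y : Matrix ι ι ℂ}
    {Z : Matrix κ κ ℂ} (hY : Y.PosSemidef) (hZ : Z.PosSemidef) :
    ENNReal.ofReal (psi p q (Y ⊗ₖ Z)) ≤ ncSup p q (Y ⊗ₖ Z) := by
  have hp0 : 0 < p := by linarith
  have hq0 : 0 < q := by linarith
  rw [psi_kronecker hp0 hq0 hY hZ]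
  have hS := trace_re_nonneg (psdPow_posSemidef hY q)
  have hR := trace_re_nonneg (psdPow_posSemidef hZ p)
  have hγ : 0 ≤ (q / p - 1) / 2 := by
    have : 1 ≤ q / p := by rw [le_div_iff₀ hp0]; linarith
    linarith
  have hprod : (psdPow Y ((q / p - 1) / 2) ⊗ₖ (1 : Matrix κ κ ℂ)) * (Y ⊗ₖ Z)
      * (psdPow Y ((q / p - 1) / 2) ⊗ₖ (1 : Matrix κ κ ℂ)) = psdPow Y (q / p) ⊗ₖ Z := by
    rw [← Matrix.mul_kronecker_mul, ← Matrix.mul_kronecker_mul, Matrix.one_mul, Matrix.mul_one]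
    congr 1
    nth_rewrite 2 [← psdPow_one hY]
    rw [psdPow_mul_psdPow hY hγ zero_le_one, psdPow_mul_psdPow hY (by linarith) hγ]
    congr 1
    ring
  have hnum : schattenNorm (ENNReal.ofReal p) (psdPow Y (q / p) ⊗ₖ Z)
      = (psdPow Y q).trace.re ^ (1 / p) * (psdPow Z p).trace.re ^ (1 / p) := by
    rw [schattenNorm_of_posSemidef hp0.le ((psdPow_posSemidef hY _).kronecker hZ),
      psdPow_kronecker (psdPow_posSemidef hY _) hZ, psdPow_psdPow hY, div_mul_cancel₀ _ hp0.ne',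
      Matrix.trace_kronecker, trace_eq_re (psdPow_posSemidef hY q), Complex.re_ofReal_mul,
      Complex.ofReal_re, Real.mul_rpow hS hR]
  refine le_trans (ENNReal.ofReal_le_ofReal ?_) (le_iSup₂ (f := fun A B : Matrix ι ι ℂ =>
    ENNReal.ofReal (schattenNorm (ENNReal.ofReal p)
          ((A ⊗ₖ (1 : Matrix κ κ ℂ)) * (Y ⊗ₖ Z) * (B ⊗ₖ (1 : Matrix κ κ ℂ)))
        / (schattenNorm (2 * rExp p q) A * schattenNorm (2 * rExp p q) B)))
    (psdPow Y ((q / p - 1) / 2)) (psdPow Y ((q / p - 1) / 2)))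
  rw [hprod, hnum]
  rcases hS.eq_or_lt with hS0 | hS0
  · rw [← hS0, Real.zero_rpow (by positivity), Real.zero_rpow (by positivity)]
    simp
  rcases hpq.eq_or_lt with rfl | hlt
  · -- for `p = q` the test matrices are the identity, which has operator norm `1`
    have : Nonempty ι := by
      by_contra h
      rw [not_nonempty_iff] at h
      simp [Matrix.trace] at hS0
    have hn : schattenNorm ∞ (1 : Matrix ι ι ℂ) = 1 := by
      rw [schattenNorm, if_pos rfl, map_one, norm_one]
    rw [two_mul_rExp_self, div_self hp0.ne', sub_self, zero_div, psdPow_zero hY, hn]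
    simp
  · have hlt' : 1 / q < 1 / p := one_div_lt_one_div_of_lt hp0 hlt
    have hpos : 0 < 1 / p - 1 / q := sub_pos.2 hlt'
    have hd : max (1 / p) (1 / q) - min (1 / p) (1 / q) = 1 / p - 1 / q := by
      rw [max_eq_left hlt'.le, min_eq_right hlt'.le]
    have hρ0 := inv_pos.2 hpos
    have he : (q / p - 1) / 2 * (2 * (1 / p - 1 / q)⁻¹) = q := by
      have : q - p ≠ 0 := by linarith
      have h : 1 / p - 1 / q = (q - p) / (p * q) := by field_simp
      rw [h]
      field_simp
    have h1 : 1 / (2 * (1 / p - 1 / q)⁻¹) + 1 / (2 * (1 / p - 1 / q)⁻¹) = 1 / p - 1 / q := by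
      rw [one_div, mul_inv, inv_inv]
      ring
    rw [two_mul_rExp (by rwa [hd]), hd, schattenNorm_of_posSemidef (by positivity)
      (psdPow_posSemidef hY _), psdPow_psdPow hY, he, ← Real.rpow_add hS0, h1, mul_div_right_comm,
      ← Real.rpow_sub hS0, sub_sub_cancel]

/-- Hölder's inequality on the outside space with exponents `r/s` and `q'/s`, where `q'` is
conjugate to `q`; for `q = 1` the second exponent is infinite and `psdPow Y 0 = 1`. -/
theorem trace_psdPow_mul_le_of_lt {p q s : ℝ} (hq : 1 ≤ q) (hpq : q < p)
    (hps : p.HolderConjugate s) (A : Matrix ι ι ℂ) {Y : Matrix ι ι ℂ} (hY : Y.PosSemidef) :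
    (psdPow (Aᴴ * A) s * psdPow Y ((q - 1) * s)).trace.re
      ≤ schattenNorm (2 * rExp p q) A ^ (2 * s) * (psdPow Y q).trace.re ^ (s * (1 - 1 / q)) := by
  have hq0 : 0 < q := by linarith
  have hp0 : 0 < p := by linarith
  have hs0 := hps.symm.pos
  have hlt' : 1 / p < 1 / q := one_div_lt_one_div_of_lt hq0 hpq
  have hpos : 0 < 1 / q - 1 / p := sub_pos.2 hlt'
  have hd : max (1 / p) (1 / q) - min (1 / p) (1 / q) = 1 / q - 1 / p := by
    rw [max_eq_right hlt'.le, min_eq_left hlt'.le]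
  have hρ0 := inv_pos.2 hpos
  rw [two_mul_rExp (by rwa [hd]), hd, schattenNorm_two_mul_rpow hρ0]
  have hs : 1 / p = 1 - 1 / s := by
    have := hps.inv_add_inv_eq_one
    rw [one_div, one_div]
    linarith
  have hθ : s / (1 / q - 1 / p)⁻¹ = 1 - s * (1 - 1 / q) := by
    rw [hs, div_inv_eq_mul]
    field_simp
    ring
  have hq1 : 1 / q ≤ 1 := by rw [div_le_one hq0]; exact hq
  have h := trace_psdPow_mul_psdPow_le (Matrix.posSemidef_conjTranspose_mul_self A) hY
    (1 / q - 1 / p)⁻¹ q (θ := s / (1 / q - 1 / p)⁻¹) (by positivity)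
    (by rw [hθ]; have := mul_nonneg hs0.le (sub_nonneg.2 hq1); linarith)
  have h1 : 1 - s / (1 / q - 1 / p)⁻¹ = s * (1 - 1 / q) := by rw [hθ]; ring
  have h2 : q * (s * (1 - 1 / q)) = (q - 1) * s := by field_simp
  rwa [h1, h2, mul_div_cancel₀ _ hρ0.ne'] at h

theorem psi_kronecker_le_ncInf {p q : ℝ} (hq : 1 ≤ q) (hpq : q < p) {Y : Matrix ι ι ℂ}
    {Z : Matrix κ κ ℂ} (hY : Y.PosSemidef) (hZ : Z.PosSemidef) :
    ENNReal.ofReal (psi p q (Y ⊗ₖ Z)) ≤ ncInf p q (Y ⊗ₖ Z) := by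
  have hq0 : 0 < q := by linarith
  have hp1 : 1 < p := by linarith
  have hp0 : 0 < p := by linarith
  rw [psi_kronecker hp0 hq0 hY hZ]
  refine le_iInf fun N => le_iInf fun A => le_iInf fun B => le_iInf fun X => le_iInf fun hX =>
    ENNReal.ofReal_le_ofReal ?_
  have hS := trace_re_nonneg (psdPow_posSemidef hY q)
  have hR := trace_re_nonneg (psdPow_posSemidef hZ p)
  set S := (psdPow Y q).trace.re
  set R := (psdPow Z p).trace.re
  have hsn := fun (s : ℝ≥0∞) (A : Matrix ι ι ℂ) => schattenNorm_nonneg s A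
  have hnn : 0 ≤ ∑ i, schattenNorm (2 * rExp p q) (A i) * schattenNorm (2 * rExp p q) (B i)
        * schattenNorm (ENNReal.ofReal p) (X i) := Finset.sum_nonneg fun i _ =>
    mul_nonneg (mul_nonneg (hsn _ _) (hsn _ _)) (schattenNorm_nonneg _ _)
  rcases hS.eq_or_lt with hS0 | hS0
  · rw [← hS0, Real.zero_rpow (by positivity), zero_mul]
    exact hnn
  rcases hR.eq_or_lt with hR0 | hR0
  · rw [← hR0, Real.zero_rpow (by positivity), mul_zero]
    exact hnn
  have hps := Real.HolderConjugate.conjExponent hp1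
  set s := p.conjExponent
  have hs0 : 0 < s := hps.symm.pos
  -- the element of the dual space that norms `Y ⊗ Z`
  let W := psdPow Y (q - 1) ⊗ₖ psdPow Z (p - 1)
  have hW : W.PosSemidef := (psdPow_posSemidef hY _).kronecker (psdPow_posSemidef hZ _)
  have hWs : psdPow W s = psdPow Y ((q - 1) * s) ⊗ₖ psdPow Z p := by
    rw [psdPow_kronecker (psdPow_posSemidef hY _) (psdPow_posSemidef hZ _), psdPow_psdPow hY,
      psdPow_psdPow hZ, hps.sub_one_mul_conj]
  have hWtr : (W * (Y ⊗ₖ Z)).trace = ((S * R : ℝ) : ℂ) := by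
    rw [← Matrix.mul_kronecker_mul, Matrix.trace_kronecker]
    nth_rewrite 2 [← psdPow_one hY]
    nth_rewrite 2 [← psdPow_one hZ]
    rw [psdPow_mul_psdPow hY (by linarith) zero_le_one,
      psdPow_mul_psdPow hZ (by linarith) zero_le_one, sub_add_cancel, sub_add_cancel,
      trace_eq_re (psdPow_posSemidef hY q), trace_eq_re (psdPow_posSemidef hZ p)]
    push_cast
    rfl
  have hbound : ∀ C : Matrix ι ι ℂ,
      ((psdPow (Cᴴ * C) s ⊗ₖ (1 : Matrix κ κ ℂ)) * psdPow W s).trace.re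
      ≤ schattenNorm (2 * rExp p q) C ^ (2 * s) * (S ^ (s * (1 - 1 / q)) * R) := by
    intro C
    rw [hWs, ← Matrix.mul_kronecker_mul, Matrix.trace_kronecker, Matrix.one_mul,
      trace_eq_re (psdPow_posSemidef hZ p), Complex.re_mul_ofReal, ← mul_assoc]
    exact mul_le_mul_of_nonneg_right (trace_psdPow_mul_le_of_lt hq hpq hps C hY) hR
  have hterm : ∀ i, ‖(W * ((A i ⊗ₖ (1 : Matrix κ κ ℂ)) * X i * (B i ⊗ₖ (1 : Matrix κ κ ℂ)))).trace‖
      ≤ schattenNorm (2 * rExp p q) (A i) * schattenNorm (2 * rExp p q) (B i)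
        * schattenNorm (ENNReal.ofReal p) (X i) * (S ^ (1 - 1 / q) * R ^ (1 / s)) := by
    intro i
    have hcyc : (W * ((A i ⊗ₖ (1 : Matrix κ κ ℂ)) * X i * (B i ⊗ₖ (1 : Matrix κ κ ℂ)))).trace
        = (X i * ((B i ⊗ₖ (1 : Matrix κ κ ℂ)) * W * (A i ⊗ₖ (1 : Matrix κ κ ℂ)))).trace := by
      calc _ = ((W * (A i ⊗ₖ (1 : Matrix κ κ ℂ))) * (X i * (B i ⊗ₖ (1 : Matrix κ κ ℂ)))).trace := by
            simp only [mul_assoc]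
        _ = _ := by rw [Matrix.trace_mul_comm]; simp only [mul_assoc]
    rw [hcyc]
    refine (norm_trace_mul_mul_mul_le hps _ _ _ hW).trans ?_
    rw [psdPow_kronecker_one, psdPow_kronecker_one_mul_conjTranspose,
      Matrix.trace_mul_comm (psdPow W s)]
    have h1 := hbound (B i)
    have h2 := hbound (A i)ᴴ
    rw [schattenNorm_conjTranspose] at h2
    have hτ : 0 ≤ S ^ (s * (1 - 1 / q)) * R := by positivity
    have h3 := sqrt_mul_sqrt_rpow (hsn (2 * rExp p q) (B i)) (hsn (2 * rExp p q) (A i)) hτ hs0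
    have h4 : (S ^ (s * (1 - 1 / q)) * R) ^ (1 / s) = S ^ (1 - 1 / q) * R ^ (1 / s) := by
      rw [Real.mul_rpow (by positivity) hR, ← Real.rpow_mul hS]
      congr 2
      field_simp
    rw [h4] at h3
    calc _ ≤ schattenNorm (ENNReal.ofReal p) (X i) *
          (schattenNorm (2 * rExp p q) (B i) * schattenNorm (2 * rExp p q) (A i)
            * (S ^ (1 - 1 / q) * R ^ (1 / s))) := by
          rw [← h3]
          have := schattenNorm_nonneg (ENNReal.ofReal p) (X i)
          gcongr
      _ = _ := by ring
  have hsum : S * R ≤ (∑ i, schattenNorm (2 * rExp p q) (A i) * schattenNorm (2 * rExp p q) (B i)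
        * schattenNorm (ENNReal.ofReal p) (X i)) * (S ^ (1 - 1 / q) * R ^ (1 / s)) := by
    have h1 : ‖(W * (Y ⊗ₖ Z)).trace‖ = S * R := by
      rw [hWtr, Complex.norm_real, Real.norm_of_nonneg (by positivity)]
    rw [← h1, hX, Finset.mul_sum, Matrix.trace_sum, Finset.sum_mul]
    exact (norm_sum_le _ _).trans (Finset.sum_le_sum fun i _ => hterm i)
  have hs : 1 / s = 1 - 1 / p := by
    have := hps.inv_add_inv_eq_one
    rw [one_div, one_div]
    linarith
  rw [hs, ← div_le_iff₀ (by positivity)] at hsum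
  refine le_trans (le_of_eq ?_) hsum
  rw [mul_div_mul_comm]
  congr 1
  · conv_rhs => rw [← Real.rpow_one S, ← Real.rpow_mul hS, one_mul, ← Real.rpow_sub hS0,
      sub_sub_cancel]
  · conv_rhs => rw [← Real.rpow_one R, ← Real.rpow_mul hR, one_mul, ← Real.rpow_sub hR0,
      sub_sub_cancel]

/-- A positive elementary tensor is a tensor product of positive matrices: rescale the factors by
the traces. -/
theorem exists_posSemidef_kronecker {Y : Matrix ι ι ℂ} {Z : Matrix κ κ ℂ}
    (h : (Y ⊗ₖ Z).PosSemidef) :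
    ∃ (Y' : Matrix ι ι ℂ) (Z' : Matrix κ κ ℂ), Y'.PosSemidef ∧ Z'.PosSemidef ∧
      Y ⊗ₖ Z = Y' ⊗ₖ Z' := by
  by_cases h0 : (Y ⊗ₖ Z).trace = 0
  · refine ⟨0, 0, Matrix.PosSemidef.zero, Matrix.PosSemidef.zero, ?_⟩
    rw [h.trace_eq_zero_iff.1 h0, Matrix.zero_kronecker]
  have hc := h.trace_nonneg
  rw [Matrix.trace_kronecker] at h0 hc
  have hZ0 : Z.trace ≠ 0 := right_ne_zero_of_mul h0
  have hY0 : Y.trace ≠ 0 := left_ne_zero_of_mul h0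
  have h2 : (Y.trace • Z).PosSemidef := by
    have : Y.trace • Z = ∑ i : ι, (Y ⊗ₖ Z).submatrix (fun k => (i, k)) (fun k => (i, k)) := by
      ext k l
      simp [Matrix.sum_apply, Matrix.trace, Finset.sum_mul]
    rw [this]
    exact Matrix.posSemidef_sum _ fun i _ => h.submatrix _
  refine ⟨Z.trace • Y, (Y.trace * Z.trace)⁻¹ • (Y.trace • Z), ?_, h2.smul (inv_nonneg.2 hc), ?_⟩
  · rw [← partialTrace₂_kronecker]
    exact partialTrace₂_posSemidef h
  · rw [Matrix.smul_kronecker, Matrix.kronecker_smul, Matrix.kronecker_smul, smul_smul, smul_smul]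
    have : Z.trace * ((Y.trace * Z.trace)⁻¹ * Y.trace) = 1 := by field_simp
    rw [← mul_assoc] at this
    rw [this, one_smul]

theorem ncNorm_kronecker {p q : ℝ} (hp : 1 ≤ p) (hq : 1 ≤ q) {Y : Matrix ι ι ℂ}
    {Z : Matrix κ κ ℂ} (h : (Y ⊗ₖ Z).PosSemidef) :
    ncNorm p q (Y ⊗ₖ Z) = ENNReal.ofReal (psi p q (Y ⊗ₖ Z)) := by
  refine le_antisymm (ncNorm_le_psi hp hq h) ?_
  obtain ⟨Y', Z', hY, hZ, he⟩ := exists_posSemidef_kronecker h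
  rw [he]
  unfold ncNorm
  split_ifs with hpq
  · exact psi_kronecker_le_ncSup hp hpq hY hZ
  · exact psi_kronecker_le_ncInf hq (not_le.1 hpq) hY hZ

/-! ### Comparison with the Carlen–Lieb norm -/

theorem ncSup_sub_le {p q : ℝ} (hp : 1 ≤ p) (X Y : Matrix (ι × κ) (ι × κ) ℂ) :
    ncSup p q (X - Y) ≤ ncSup p q X + ncSup p q Y := by
  refine iSup₂_le fun A B => ?_
  have hA := schattenNorm_nonneg (2 * rExp p q) A
  have hB := schattenNorm_nonneg (2 * rExp p q) B
  refine le_trans ?_ (add_le_add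
    (le_iSup₂ (f := fun A B : Matrix ι ι ℂ => ENNReal.ofReal (schattenNorm (ENNReal.ofReal p)
          ((A ⊗ₖ (1 : Matrix κ κ ℂ)) * X * (B ⊗ₖ (1 : Matrix κ κ ℂ)))
        / (schattenNorm (2 * rExp p q) A * schattenNorm (2 * rExp p q) B))) A B)
    (le_iSup₂ (f := fun A B : Matrix ι ι ℂ => ENNReal.ofReal (schattenNorm (ENNReal.ofReal p)
          ((A ⊗ₖ (1 : Matrix κ κ ℂ)) * Y * (B ⊗ₖ (1 : Matrix κ κ ℂ)))
        / (schattenNorm (2 * rExp p q) A * schattenNorm (2 * rExp p q) B))) A B))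
  rw [← ENNReal.ofReal_add (div_nonneg (schattenNorm_nonneg _ _) (mul_nonneg hA hB))
    (div_nonneg (schattenNorm_nonneg _ _) (mul_nonneg hA hB)), ← add_div]
  refine ENNReal.ofReal_le_ofReal (div_le_div_of_nonneg_right ?_ (mul_nonneg hA hB))
  rw [mul_sub, sub_mul]
  exact schattenNorm_sub_le hp _ _

theorem ncInf_sub_le (p q : ℝ) (X Y : Matrix (ι × κ) (ι × κ) ℂ) :
    ncInf p q (X - Y) ≤ ncInf p q X + ncInf p q Y := by
  conv_rhs => unfold ncInf
  simp only [ENNReal.iInf_add, ENNReal.add_iInf]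
  refine le_iInf fun N' => le_iInf fun A' => le_iInf fun B' => le_iInf fun Z' => le_iInf fun hY =>
    le_iInf fun N => le_iInf fun A => le_iInf fun B => le_iInf fun Z => le_iInf fun hX => ?_
  refine iInf_le_of_le (N + N') (iInf_le_of_le (Fin.append A A') (iInf_le_of_le (Fin.append B B')
    (iInf_le_of_le (Fin.append Z fun i => -Z' i) (iInf_le_of_le ?_ ?_))))
  · rw [Fin.sum_univ_add, hX, hY]
    simp [sub_eq_add_neg]
  · have hnn : ∀ (N : ℕ) (A B : Fin N → Matrix ι ι ℂ) (Z : Fin N → Matrix (ι × κ) (ι × κ) ℂ),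
        0 ≤ ∑ i, schattenNorm (2 * rExp p q) (A i) * schattenNorm (2 * rExp p q) (B i)
        * schattenNorm (ENNReal.ofReal p) (Z i) := fun N A B Z => Finset.sum_nonneg fun i _ =>
      mul_nonneg (mul_nonneg (schattenNorm_nonneg _ _) (schattenNorm_nonneg _ _))
        (schattenNorm_nonneg _ _)
    rw [← ENNReal.ofReal_add (hnn _ _ _ _) (hnn _ _ _ _), Fin.sum_univ_add]
    simp [schattenNorm_neg]

theorem ncNorm_sub_le {p q : ℝ} (hp : 1 ≤ p) (X Y : Matrix (ι × κ) (ι × κ) ℂ) :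
    ncNorm p q (X - Y) ≤ ncNorm p q X + ncNorm p q Y := by
  unfold ncNorm
  split_ifs
  · exact ncSup_sub_le hp X Y
  · exact ncInf_sub_le p q X Y

section Compression

open scoped Matrix.Norms.L2Operator

variable {μ : Type*} [Fintype μ] [DecidableEq μ]

theorem norm_one_kronecker_le {K : Matrix κ μ ℂ} (hK : K * Kᴴ = 1) :
    ‖(1 : Matrix ι ι ℂ) ⊗ₖ K‖ ≤ 1 := by
  have h := Matrix.l2_opNorm_conjTranspose_mul_self ((1 : Matrix ι ι ℂ) ⊗ₖ K)ᴴ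
  rw [Matrix.conjTranspose_conjTranspose, Matrix.l2_opNorm_conjTranspose,
    Matrix.conjTranspose_kronecker, Matrix.conjTranspose_one, ← Matrix.mul_kronecker_mul, hK,
    Matrix.mul_one, Matrix.one_kronecker_one] at h
  have h1 : ‖(1 : Matrix (ι × κ) (ι × κ) ℂ)‖ ≤ 1 := norm_unitary_le_one (one_mem _)
  nlinarith [norm_nonneg ((1 : Matrix ι ι ℂ) ⊗ₖ K)]

theorem schattenNorm_inner_compression_le {p : ℝ} (hp : 1 ≤ p) {K L : Matrix κ μ ℂ}
    (hK : K * Kᴴ = 1) (hL : L * Lᴴ = 1) (X : Matrix (ι × μ) (ι × μ) ℂ) :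
    schattenNorm (ENNReal.ofReal p) (((1 : Matrix ι ι ℂ) ⊗ₖ K) * X * ((1 : Matrix ι ι ℂ) ⊗ₖ L)ᴴ)
      ≤ schattenNorm (ENNReal.ofReal p) X := by
  refine schattenNorm_compression_le hp (norm_one_kronecker_le hK) ?_ X
  rw [Matrix.l2_opNorm_conjTranspose]
  exact norm_one_kronecker_le hL

/-- Outer multiplications commute with compressions of the inner space. -/
theorem outer_mul_inner_compression (A B : Matrix ι ι ℂ) (K L : Matrix κ μ ℂ)
    (X : Matrix (ι × μ) (ι × μ) ℂ) :
    (A ⊗ₖ (1 : Matrix κ κ ℂ)) * (((1 : Matrix ι ι ℂ) ⊗ₖ K) * X * ((1 : Matrix ι ι ℂ) ⊗ₖ L)ᴴ)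
        * (B ⊗ₖ (1 : Matrix κ κ ℂ))
      = ((1 : Matrix ι ι ℂ) ⊗ₖ K) * ((A ⊗ₖ (1 : Matrix μ μ ℂ)) * X * (B ⊗ₖ (1 : Matrix μ μ ℂ)))
        * ((1 : Matrix ι ι ℂ) ⊗ₖ L)ᴴ := by
  have h1 : (A ⊗ₖ (1 : Matrix κ κ ℂ)) * ((1 : Matrix ι ι ℂ) ⊗ₖ K)
      = ((1 : Matrix ι ι ℂ) ⊗ₖ K) * (A ⊗ₖ (1 : Matrix μ μ ℂ)) := by
    simp only [← Matrix.mul_kronecker_mul, Matrix.mul_one, Matrix.one_mul]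
  have h2 : ((1 : Matrix ι ι ℂ) ⊗ₖ L)ᴴ * (B ⊗ₖ (1 : Matrix κ κ ℂ))
      = (B ⊗ₖ (1 : Matrix μ μ ℂ)) * ((1 : Matrix ι ι ℂ) ⊗ₖ L)ᴴ := by
    simp only [Matrix.conjTranspose_kronecker, Matrix.conjTranspose_one,
      ← Matrix.mul_kronecker_mul, Matrix.mul_one, Matrix.one_mul]
  calc _ = ((A ⊗ₖ (1 : Matrix κ κ ℂ)) * ((1 : Matrix ι ι ℂ) ⊗ₖ K)) * X
        * (((1 : Matrix ι ι ℂ) ⊗ₖ L)ᴴ * (B ⊗ₖ (1 : Matrix κ κ ℂ))) := by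
        simp only [Matrix.mul_assoc]
    _ = _ := by rw [h1, h2]; simp only [Matrix.mul_assoc]

theorem ncNorm_inner_compression_le {p q : ℝ} (hp : 1 ≤ p) {K L : Matrix κ μ ℂ}
    (hK : K * Kᴴ = 1) (hL : L * Lᴴ = 1) (X : Matrix (ι × μ) (ι × μ) ℂ) :
    ncNorm p q (((1 : Matrix ι ι ℂ) ⊗ₖ K) * X * ((1 : Matrix ι ι ℂ) ⊗ₖ L)ᴴ) ≤ ncNorm p q X := by
  have hn := fun A : Matrix ι ι ℂ => schattenNorm_nonneg (2 * rExp p q) A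
  unfold ncNorm
  split_ifs
  · refine iSup₂_mono fun A B => ENNReal.ofReal_le_ofReal ?_
    rw [outer_mul_inner_compression]
    exact div_le_div_of_nonneg_right (schattenNorm_inner_compression_le hp hK hL _)
      (mul_nonneg (hn A) (hn B))
  · refine le_iInf fun N => le_iInf fun A => le_iInf fun B => le_iInf fun Z => le_iInf fun hX => ?_
    refine iInf_le_of_le N (iInf_le_of_le A (iInf_le_of_le B (iInf_le_of_le
      (fun i => ((1 : Matrix ι ι ℂ) ⊗ₖ K) * Z i * ((1 : Matrix ι ι ℂ) ⊗ₖ L)ᴴ)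
      (iInf_le_of_le ?_ (ENNReal.ofReal_le_ofReal (Finset.sum_le_sum fun i _ => ?_))))))
    · simp only [outer_mul_inner_compression]
      rw [hX, Matrix.mul_sum, Matrix.sum_mul]
    · exact mul_le_mul_of_nonneg_left (schattenNorm_inner_compression_le hp hK hL _)
        (mul_nonneg (hn _) (hn _))

end Compression

/-- The coisometry from `ℂ^κ ⊗ ℂ²` onto the copy of `ℂ^κ` with second index `s`. -/
def blockProj (κ : Type*) [DecidableEq κ] (s : Fin 2) : Matrix κ (κ × Fin 2) ℂ :=
  Matrix.of fun k x => if x = (k, s) then 1 else 0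

theorem blockProj_mul_conjTranspose (s : Fin 2) : blockProj κ s * (blockProj κ s)ᴴ = 1 := by
  ext k l
  simp [blockProj, Matrix.mul_apply, Matrix.one_apply, eq_comm]

theorem compression_hermitize (Y : Matrix (ι × κ) (ι × κ) ℂ) :
    ((1 : Matrix ι ι ℂ) ⊗ₖ blockProj κ 0) * hermitize Y * ((1 : Matrix ι ι ℂ) ⊗ₖ blockProj κ 1)ᴴ
      = Y := by
  ext ⟨i, k⟩ ⟨j, l⟩
  have h : ∀ (s : Fin 2) (i : ι) (k : κ) (x : ι × (κ × Fin 2)),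
      ((1 : Matrix ι ι ℂ) ⊗ₖ blockProj κ s) (i, k) x = if x = (i, (k, s)) then 1 else 0 := by
    rintro s i k ⟨i', k', s'⟩
    simp only [Matrix.kroneckerMap_apply, Matrix.one_apply, blockProj, Matrix.of_apply,
      Prod.mk.injEq, ← ite_and, ite_mul, one_mul, zero_mul, eq_comm (a := i)]
  simp only [Matrix.mul_apply, Matrix.conjTranspose_apply, h]
  simp [hermitize, apply_ite]

theorem exists_posSemidef_add_eq {X : Matrix ι ι ℂ} (hX : X.IsHermitian) :
    ∃ A B : Matrix ι ι ℂ, A.PosSemidef ∧ B.PosSemidef ∧ X + A = B := by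
  let U : Matrix ι ι ℂ := hX.eigenvectorUnitary
  have hspec : X = U * realDiag hX.eigenvalues * Uᴴ := hX.spectral_theorem
  refine ⟨U * realDiag (fun i => max (-hX.eigenvalues i) 0) * Uᴴ,
    U * realDiag (fun i => max (hX.eigenvalues i) 0) * Uᴴ,
    posSemidef_conj_realDiag U fun i => le_max_right _ _,
    posSemidef_conj_realDiag U fun i => le_max_right _ _, ?_⟩
  nth_rewrite 1 [hspec]
  rw [← add_mul, ← mul_add, Matrix.diagonal_add]
  congr 3
  ext i
  rw [← Complex.ofReal_add]
  congr 1
  change hX.eigenvalues i + max (-hX.eigenvalues i) 0 = max (hX.eigenvalues i) 0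
  rcases le_total 0 (hX.eigenvalues i) with h | h
  · rw [max_eq_left h, max_eq_right (by linarith), add_zero]
  · rw [max_eq_right h, max_eq_left (by linarith), add_neg_cancel]

theorem hermitize_isHermitian (Y : Matrix (ι × κ) (ι × κ) ℂ) : (hermitize Y).IsHermitian := by
  ext ⟨i, k, s⟩ ⟨j, l, t⟩
  fin_cases s <;> fin_cases t <;> simp [hermitize]

theorem ncNorm_le_tripleNorm {p q : ℝ} (hp : 1 ≤ p) (hq : 1 ≤ q)
    (Y : Matrix (ι × κ) (ι × κ) ℂ) :
    ncNorm p q Y ≤ ENNReal.ofReal (tripleNorm p q (hermitize Y)) := by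
  have hle : ∀ A B : Matrix (ι × (κ × Fin 2)) (ι × (κ × Fin 2)) ℂ, A.PosSemidef → B.PosSemidef →
      hermitize Y + A = B → ncNorm p q Y ≤ ENNReal.ofReal (psi p q A + psi p q B) := by
    intro A B hA hB hAB
    have hH : hermitize Y = B - A := by rw [← hAB, add_sub_cancel_right]
    rw [← compression_hermitize Y]
    refine (ncNorm_inner_compression_le hp (blockProj_mul_conjTranspose 0)
      (blockProj_mul_conjTranspose 1) _).trans ?_
    rw [hH, add_comm (psi p q A), ENNReal.ofReal_add (psi_nonneg p q hB) (psi_nonneg p q hA)]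
    exact (ncNorm_sub_le hp B A).trans
      (add_le_add (ncNorm_le_psi hp hq hB) (ncNorm_le_psi hp hq hA))
  obtain ⟨A₀, B₀, hA₀, hB₀, h₀⟩ := exists_posSemidef_add_eq (hermitize_isHermitian Y)
  have hfin : ncNorm p q Y ≠ ∞ := ne_top_of_le_ne_top ENNReal.ofReal_ne_top (hle A₀ B₀ hA₀ hB₀ h₀)
  rw [← ENNReal.ofReal_toReal hfin]
  refine ENNReal.ofReal_le_ofReal (le_csInf ⟨_, A₀, B₀, hA₀, hB₀, h₀, rfl⟩ ?_)
  rintro _ ⟨A, B, hA, hB, hAB, rfl⟩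
  exact ENNReal.toReal_le_of_le_ofReal (add_nonneg (psi_nonneg p q hA) (psi_nonneg p q hB))
    (hle A B hA hB hAB)

theorem tripleNorm_nonneg (p q : ℝ) (X : Matrix (ι × κ) (ι × κ) ℂ) : 0 ≤ tripleNorm p q X := by
  refine Real.sInf_nonneg ?_
  rintro _ ⟨A, B, hA, hB, -, rfl⟩
  exact add_nonneg (psi_nonneg p q hA) (psi_nonneg p q hB)

end BipartiteNorm

end

theorem theorem1 (n m : ℕ) (p q : ℝ) (hp1 : 1 ≤ p) (hp2 : p ≤ 2) (hq : 1 ≤ q) :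
    (∀ Y : Matrix (Fin n × Fin m) (Fin n × Fin m) ℂ, Y.PosSemidef →
      BipartiteNorm.ncNorm p q Y ≤ ENNReal.ofReal (BipartiteNorm.psi p q Y)) ∧
    (∀ (Y₁ : Matrix (Fin n) (Fin n) ℂ) (Y₂ : Matrix (Fin m) (Fin m) ℂ),
      (Y₁ ⊗ₖ Y₂).PosSemidef →
      BipartiteNorm.ncNorm p q (Y₁ ⊗ₖ Y₂)
        = ENNReal.ofReal (BipartiteNorm.psi p q (Y₁ ⊗ₖ Y₂))) ∧
    (∀ Y : Matrix (Fin n × Fin m) (Fin n × Fin m) ℂ,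
      BipartiteNorm.ncNorm p q Y
        ≤ ENNReal.ofReal ((2 : ℝ) ^ (3 - 1 / p) * BipartiteNorm.clNorm p q Y)) := by
  refine ⟨fun Y hY => BipartiteNorm.ncNorm_le_psi hp1 hq hY,
    fun Y₁ Y₂ h => BipartiteNorm.ncNorm_kronecker hp1 hq h, fun Y => ?_⟩
  refine (BipartiteNorm.ncNorm_le_tripleNorm hp1 hq Y).trans (ENNReal.ofReal_le_ofReal ?_)
  have h0 := BipartiteNorm.tripleNorm_nonneg p q (BipartiteNorm.hermitize Y)
  have h1 : 1 / p ≤ 1 := by rw [div_le_one (by linarith)]; exact hp1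
  -- the factor `2` that undoes the `1/2` in the Carlen–Lieb norm is already enough
  have h2 : (2 : ℝ) ≤ 2 ^ (3 - 1 / p) := by
    calc (2 : ℝ) = 2 ^ (1 : ℝ) := (Real.rpow_one 2).symm
      _ ≤ _ := Real.rpow_le_rpow_of_exponent_le one_le_two (by linarith)
  rw [BipartiteNorm.clNorm]
  nlinarith
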